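/- Let $K$ be a non-archimedean local field with ring of integers $\mathcal O$ and maximal ideal $\pi\mathcal O$, and give $\mathrm{SL}_2(K)$ the topology inherited from $K^4$. Let $T$ be the Bruhat–Tits tree of $K$: its vertices are the classes of lattices in $K^2$ (free $\mathcal O$-submodules of rank two) up to scaling by $K^\times$, and two vertices are adjacent if they are represented by lattices $L_0\subseteq L$ with $L/L_0\cong \mathcal O/\pi\mathcal O$. The group $\mathrm{SL}_2(K)$ acts on $T$, and for $g\in \mathrm{SL}_2(K)$ let $l(g)=\min_{x} d(x,gx)$, the minimum over the vertices $x$ of $T$ with respect to the path metric $d$. Given $A,B\in\mathrm{SL}_2(K)$, consider the following algorithm. 1. Set $X=A$, $Y=B$. If $l(X)=0$ or $l(Y)=0$, return false. 2. If $l(X)>l(Y)$, swap $X$ and $Y$. 3. Compute $m=\min\{l(XY),\,l(X^{-1}Y)\}$. 4. If $m=0$, return false. 5. If $m\le l(Y)-l(X)$, replace $Y$ by an element of $\{XY,X^{-1}Y\}$ of translation length $m$ and return to step 2. 6. Otherwise return true and the pair $(X,Y)$. **Theorem.** For every non-archimedean local field $K$ and all $A,B\in\mathrm{SL}_2(K)$,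 the algorithm terminates after finitely many steps, whatever choices are made in step 5 (there is a bound on the number of steps depending only on $K,A,B$), and its output is correct: if $G=\langle A,B\rangle$ is discrete and free of rank two, then it returns true and a pair $(X,Y)$ which generates $G$ and satisfies the hypotheses of the Ping Pong Lemma for the action of $\mathrm{SL}_2(K)$ on (the geometric realization of) $T$; otherwise it returns false. Here a pair $(g,h)$ in a topological group $H$ acting on a topological space $\mathcal X$ satisfies the hypotheses of the Ping Pong Lemma if $H$ is metrisable, the action map $H\times \mathcal X\to \mathcal X$ is continuous, $g\neq 1\neq h$, and there are non-empty closed pairwise disjoint subsets $U_+,U_-,V_+,V_-$ of $\mathcal X$ that do not cover $\mathcal X$ and satisfy $$g(\mathcal X\setminus U_-)\subseteq U_+,\quad g^{-1}(\mathcal X\setminus U_+)\subseteq U_-,\quad h(\mathcal X\setminus V_-)\subseteq V_+,\quad h^{-1}(\mathcal X\setminus V_+)\subseteq V_-.$$ -/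

import Mathlib

open scoped ValuativeRel MatrixGroups Pointwise

noncomputable section

namespace BruhatTits

section Tree

variable (K : Type*) [Field K] [ValuativeRel K]

/-- The lattices in `K²`: finitely generated `𝒪`-submodules spanning `K²` over `K`
(equivalently, as `𝒪` is a principal ideal domain, free `𝒪`-submodules of rank two). -/
def OLattice : Type _ :=
  {L : Submodule 𝒪[K] (Fin 2 → K) // Submodule.IsLattice K L}

variable {K}

/-- The `𝒪`-linear automorphism of `K²` given by a matrix in `SL₂(K)`. -/
def act (g : SL(2, K)) : (Fin 2 → K) ≃ₗ[𝒪[K]] (Fin 2 → K) :=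
  (Matrix.SpecialLinearGroup.toLin' g).restrictScalars 𝒪[K]

theorem act_apply (g : SL(2, K)) (x : Fin 2 → K) :
    act g x = Matrix.mulVec (g : Matrix (Fin 2) (Fin 2) K) x := rfl

theorem act_smul (g : SL(2, K)) (a : Kˣ) (x : Fin 2 → K) : act g (a • x) = a • act g x := by
  simp only [act_apply, Units.smul_def, Matrix.mulVec_smul]

theorem act_mul (g h : SL(2, K)) (x : Fin 2 → K) : act (g * h) x = act g (act h x) := by
  simp only [act_apply, Matrix.SpecialLinearGroup.coe_mul, Matrix.mulVec_mulVec]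

theorem isLattice_map (g : SL(2, K)) (L : Submodule 𝒪[K] (Fin 2 → K))
    (hL : Submodule.IsLattice K L) :
    Submodule.IsLattice K (L.map (act g).toLinearMap) where
  fg := hL.fg.map _
  span_eq_top := by
    have h : ((L.map (act g).toLinearMap : Submodule 𝒪[K] (Fin 2 → K)) : Set (Fin 2 → K))
        = (Matrix.SpecialLinearGroup.toLin' g).toLinearMap '' (L : Set (Fin 2 → K)) := rfl
    rw [h, ← Submodule.map_span, hL.span_eq_top, Submodule.map_top]
    exact LinearEquiv.range _

/-- The natural action of `SL₂(K)` on lattices. -/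
instance : MulAction SL(2, K) (OLattice K) where
  smul g L := ⟨L.1.map (act g).toLinearMap, isLattice_map g L.1 L.2⟩
  one_smul L := by
    apply Subtype.ext
    ext x
    change (∃ y, y ∈ L.1 ∧ act 1 y = x) ↔ _
    simp [act_apply]
  mul_smul g h L := by
    apply Subtype.ext
    ext x
    change (∃ y, y ∈ L.1 ∧ act (g * h) y = x) ↔
      ∃ z, (∃ y, y ∈ L.1 ∧ act h y = z) ∧ act g z = x
    simp only [exists_exists_and_eq_and, act_mul]

theorem smul_val (g : SL(2, K)) (L : OLattice K) :
    (g • L).1 = L.1.map (act g).toLinearMap := rfl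

variable (K) in
/-- Lattices `L` and `L'` are equivalent if `L = x L'` for some `x ∈ Kˣ`. -/
def latticeSetoid : Setoid (OLattice K) where
  r L L' := ∃ x : Kˣ, L.1 = x • L'.1
  iseqv :=
    { refl := fun L => ⟨1, (one_smul _ _).symm⟩
      symm := by
        rintro L L' ⟨x, hx⟩
        exact ⟨x⁻¹, by rw [hx, inv_smul_smul]⟩
      trans := by
        rintro L L' L'' ⟨x, hx⟩ ⟨y, hy⟩
        exact ⟨x * y, by rw [hx, hy, mul_smul]⟩ }

variable (K) in
/-- The vertices of the Bruhat–Tits tree: equivalence classes of lattices. -/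
def Vertex : Type _ := Quotient (latticeSetoid K)

/-- The vertex represented by a lattice. -/
def Vertex.mk (L : OLattice K) : Vertex K := Quotient.mk (latticeSetoid K) L

theorem smul_rel (g : SL(2, K)) (L L' : OLattice K) (h : (latticeSetoid K).r L L') :
    (latticeSetoid K).r (g • L) (g • L') := by
  obtain ⟨x, hx⟩ := h
  refine ⟨x, ?_⟩
  rw [smul_val, smul_val, hx]
  ext y
  simp only [Submodule.mem_map]
  constructor
  · rintro ⟨_, ⟨z, hz, rfl⟩, rfl⟩
    exact ⟨_, ⟨z, hz, rfl⟩, (act_smul g x z).symm⟩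
  · rintro ⟨_, ⟨z, hz, rfl⟩, rfl⟩
    exact ⟨_, ⟨z, hz, rfl⟩, act_smul g x z⟩

/-- The induced action of `SL₂(K)` on the vertices. -/
instance : MulAction SL(2, K) (Vertex K) where
  smul g := Quotient.map (sa := latticeSetoid K) (sb := latticeSetoid K) (g • ·)
    (fun L L' h => smul_rel g L L' h)
  one_smul := by
    rintro ⟨L⟩
    exact congrArg Vertex.mk (one_smul _ L)
  mul_smul g h := by
    rintro ⟨L⟩
    exact congrArg Vertex.mk (mul_smul g h L)

theorem smul_mk (g : SL(2, K)) (L : OLattice K) : g • Vertex.mk L = Vertex.mk (g • L) := rfl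

/-- `IsNeighbour x y`: there are lattices `L₀ ⊆ L` representing `y` and `x` respectively with
`L / L₀` isomorphic, as an `𝒪`-module, to the residue field `𝒪 / π𝒪`. -/
def IsNeighbour (x y : Vertex K) : Prop :=
  ∃ L L₀ : OLattice K, Vertex.mk L = x ∧ Vertex.mk L₀ = y ∧ L₀.1 ≤ L.1 ∧
    Nonempty ((L.1 ⧸ L₀.1.submoduleOf L.1) ≃ₗ[𝒪[K]] (𝒪[K] ⧸ 𝓂[K]))

variable (K) in
/-- The Bruhat–Tits tree. The relation `IsNeighbour` is already symmetric and irreflexive over a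
local field; `SimpleGraph.fromRel` only packages it as a graph. -/
def tree : SimpleGraph (Vertex K) := SimpleGraph.fromRel IsNeighbour

theorem IsNeighbour.smul (g : SL(2, K)) {x y : Vertex K} (h : IsNeighbour x y) :
    IsNeighbour (g • x) (g • y) := by
  obtain ⟨L, L₀, rfl, rfl, hle, ⟨e⟩⟩ := h
  refine ⟨g • L, g • L₀, rfl, rfl, Submodule.map_mono hle, ⟨?_⟩⟩
  refine LinearEquiv.trans (Submodule.Quotient.equiv _ _ ((act g).submoduleMap L.1) ?_).symm e
  ext ⟨z, hz⟩
  obtain ⟨w, hw, rfl⟩ := hz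
  constructor
  · rintro ⟨⟨a, ha⟩, ha', h⟩
    exact ⟨a, ha', congrArg Subtype.val h⟩
  · rintro ⟨a, ha, h⟩
    exact ⟨⟨a, hle ha⟩, ha, Subtype.ext h⟩

/-- `SL₂(K)` acts on the tree by graph automorphisms. -/
theorem tree_adj_smul (g : SL(2, K)) {x y : Vertex K} (h : (tree K).Adj x y) :
    (tree K).Adj (g • x) (g • y) := by
  rw [tree, SimpleGraph.fromRel_adj] at h ⊢
  exact ⟨fun e => h.1 (MulAction.injective g e), h.2.imp (.smul g) (.smul g)⟩

/-- The translation length `l(g) = min_x d(x, g x)`, over the vertices `x` of the tree, where `d`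
is the path metric. -/
def translationLength (g : SL(2, K)) : ℕ :=
  ⨅ x : Vertex K, (tree K).dist x (g • x)

end Tree

section Realization

open scoped Classical in
/-- The point at parameter `t ∈ [0,1]` between `u` and `v`, in barycentric coordinates. -/
def edgePoint {V : Type*} (u v : V) (t : ℝ) : V → ℝ :=
  (1 - t) • Pi.single u 1 + t • Pi.single v 1

/-- The geometric realization of a graph, in barycentric coordinates: vertices, and points of
edges. It carries the topology of convergence of each barycentric coordinate, which is the usual
topology when the graph is locally finite, and is the topology of the path metric. -/
def Realization {V : Type*} (T : SimpleGraph V) : Type _ :=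
  {f : V → ℝ // ∃ (u v : V) (t : ℝ),
    (u = v ∨ T.Adj u v) ∧ t ∈ Set.Icc (0 : ℝ) 1 ∧ f = edgePoint u v t}

instance {V : Type*} (T : SimpleGraph V) : TopologicalSpace (Realization T) :=
  inferInstanceAs (TopologicalSpace (Subtype _))

variable {K : Type*} [Field K] [ValuativeRel K]

theorem edgePoint_smul (g : SL(2, K)) (u v : Vertex K) (t : ℝ) :
    (fun x => edgePoint u v t (g⁻¹ • x)) = edgePoint (g • u) (g • v) t := by
  funext x
  have h : ∀ w : Vertex K, g⁻¹ • x = w ↔ x = g • w := fun w => inv_smul_eq_iff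
  simp only [edgePoint, Pi.add_apply, Pi.smul_apply, Pi.single_apply]
  congr 3 <;> exact propext (h _)

/-- The action of `SL₂(K)` on the geometric realization of its Bruhat–Tits tree, extending the
action on vertices affinely over the edges. -/
instance : MulAction SL(2, K) (Realization (tree K)) where
  smul g f := ⟨fun x => f.1 (g⁻¹ • x), by
    obtain ⟨f, u, v, t, huv, ht, rfl⟩ := f
    exact ⟨g • u, g • v, t, huv.imp (congrArg (g • ·)) (tree_adj_smul g), ht,
      edgePoint_smul g u v t⟩⟩
  one_smul f := by
    apply Subtype.ext
    funext x
    change f.1 ((1 : SL(2, K))⁻¹ • x) = f.1 x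
    rw [inv_one, one_smul]
  mul_smul g h f := by
    apply Subtype.ext
    funext x
    change f.1 ((g * h)⁻¹ • x) = f.1 (h⁻¹ • g⁻¹ • x)
    rw [mul_inv_rev, mul_smul]

end Realization

end BruhatTits

/-- The hypotheses of the Ping Pong Lemma for elements `g, h` of a metrisable topological group
`G` acting continuously on a topological space `X`. Here `U₁, U₂, V₁, V₂` are the sets commonly
written `U₊, U₋, V₊, V₋`. -/
structure PingPong {G : Type*} [Group G] [TopologicalSpace G] (X : Type*) [TopologicalSpace X]
    [MulAction G X] (g h : G) : Prop where
  isTopologicalGroup : IsTopologicalGroup G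
  metrizable : TopologicalSpace.MetrizableSpace G
  continuousSMul : ContinuousSMul G X
  left_ne_one : g ≠ 1
  right_ne_one : h ≠ 1
  exists_sets : ∃ U₁ U₂ V₁ V₂ : Set X,
    (U₁.Nonempty ∧ U₂.Nonempty ∧ V₁.Nonempty ∧ V₂.Nonempty) ∧
    (IsClosed U₁ ∧ IsClosed U₂ ∧ IsClosed V₁ ∧ IsClosed V₂) ∧
    [U₁, U₂, V₁, V₂].Pairwise Disjoint ∧
    U₁ ∪ U₂ ∪ V₁ ∪ V₂ ≠ Set.univ ∧
    g • U₂ᶜ ⊆ U₁ ∧ g⁻¹ • U₁ᶜ ⊆ U₂ ∧ h • V₂ᶜ ⊆ V₁ ∧ h⁻¹ • V₁ᶜ ⊆ V₂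

/-- The subgroup `H` is discrete (in the subspace topology) and free of rank two. -/
def IsDiscreteFreeRankTwo {G : Type*} [Group G] [TopologicalSpace G] (H : Subgroup G) : Prop :=
  DiscreteTopology H ∧ Nonempty (H ≃* FreeGroup (Fin 2))

namespace TreeAlg

/-- The states of the algorithm: `atᵢ` means that instruction `(i)` is to be carried out next, with
the current values of the variables `X`, `Y` and (once computed) `m`. -/
inductive State (G : Type*) : Type _
  | at₁ (A B : G)
  | at₂ (X Y : G)
  | at₃ (X Y : G)
  | at₄ (X Y : G) (m : ℕ)
  | at₅ (X Y : G) (m : ℕ)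
  | at₆ (X Y : G)
  | returnFalse
  | returnTrue (X Y : G)

/-- Execution of one instruction of the algorithm, for the translation length function `l`. The only
choice is in instruction `(5)`, if both `XY` and `X⁻¹Y` have translation length `m`.

(1) Set `X = A`, `Y = B`. If `l(X) = 0` or `l(Y) = 0` then return false.
(2) If `l(X) > l(Y)` then swap `X` and `Y`.
(3) Compute `m = min {l(XY), l(X⁻¹Y)}`.
(4) If `m = 0` then return false.
(5) If `m ≤ l(Y) - l(X)` then replace `Y` by an element of `{XY, X⁻¹Y}` of translation length `m`
  and return to (2).
(6) Otherwise return true and the pair `(X, Y)`. -/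
inductive Step {G : Type*} [Group G] (l : G → ℕ) : State G → State G → Prop
  | elliptic₁ {A B : G} : l A = 0 ∨ l B = 0 → Step l (.at₁ A B) .returnFalse
  | hyperbolic₁ {A B : G} : ¬(l A = 0 ∨ l B = 0) → Step l (.at₁ A B) (.at₂ A B)
  | swap₂ {X Y : G} : l X > l Y → Step l (.at₂ X Y) (.at₃ Y X)
  | keep₂ {X Y : G} : ¬(l X > l Y) → Step l (.at₂ X Y) (.at₃ X Y)
  | compute₃ {X Y : G} : Step l (.at₃ X Y) (.at₄ X Y (min (l (X * Y)) (l (X⁻¹ * Y))))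
  | elliptic₄ {X Y : G} {m : ℕ} : m = 0 → Step l (.at₄ X Y m) .returnFalse
  | hyperbolic₄ {X Y : G} {m : ℕ} : ¬(m = 0) → Step l (.at₄ X Y m) (.at₅ X Y m)
  | replace₅ {X Y Z : G} {m : ℕ} : (m : ℤ) ≤ l Y - l X → Z = X * Y ∨ Z = X⁻¹ * Y → l Z = m →
      Step l (.at₅ X Y m) (.at₂ X Z)
  | otherwise₅ {X Y : G} {m : ℕ} : ¬((m : ℤ) ≤ l Y - l X) → Step l (.at₅ X Y m) (.at₆ X Y)
  | return₆ {X Y : G} : Step l (.at₆ X Y) (.returnTrue X Y)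

/-- `Run l n s t`: some execution of exactly `n` instructions leads from state `s` to `t`. -/
inductive Run {G : Type*} [Group G] (l : G → ℕ) : ℕ → State G → State G → Prop
  | refl (s : State G) : Run l 0 s s
  | step {n : ℕ} {s t u : State G} : Run l n s t → Step l t u → Run l (n + 1) s u

/-- No instruction can be carried out in the state `s`. -/
def Halted {G : Type*} [Group G] (l : G → ℕ) (s : State G) : Prop := ∀ t, ¬ Step l s t

end TreeAlg

end

/-! The argument takes place in an integral tree metric. For lattices L, M let w(L,M) be the
logarithm of the largest |x ∧ y| with x in L, y in M. The path metric of T is 2w(L,M) − w(L,L) −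
w(M,M) (`dist_mk`). The Plücker relation and the ultrametric inequality yield the four-point
inequality, and det g = 1 makes every displacement even, so no edge is inverted (`isTreeAction`).

If the algorithm returns true, then l(XY) and l(X⁻¹Y) exceed l(Y) − l(X) ≥ 0. The axes of X and Y
then overlap, if at all, in less than l(X): a longer overlap would contain a point q with Xq and
Y^{±1}q exactly l(Y) − l(X) apart (`overlap_lt`). This leaves room for four pairwise separated
half-trees around a well-chosen base point (`exists_separated_base_point`), on which X and Y play
ping-pong. Nontrivial reduced words move the base point, whose stabilizer is open, so the group is
free and discrete. Thickened by half an edge, the half-trees become the required closed sets of the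
realization.

If it returns false, one of X, Y, XY, X⁻¹Y fixes a vertex. Vertex stabilizers are compact, so in a
discrete torsion-free group this element is trivial; but then X and Y generate a cyclic group
(`not_isDiscreteFreeRankTwo_of_translationLength_eq_zero`).

Replacing Y preserves the generated group and lowers l(X) + l(Y) by at least l(X) > 0, which bounds
the number of steps. -/

noncomputable section

/-! ### Displacements and Gromov products in an integral tree -/

/-- An action of a group by isometries of an integral tree metric, such that every group element
moves every point by an even distance. -/
structure IsTreeAction (G : Type*) {V : Type*} [Group G] [MulAction G V] (d : V → V → ℤ) :
    Prop where
  dist_self : ∀ x, d x x = 0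
  eq_of_dist : ∀ x y, d x y = 0 → x = y
  symm : ∀ x y, d x y = d y x
  smul : ∀ (g : G) x y, d (g • x) (g • y) = d x y
  four_point : ∀ x y z w, d x y + d z w ≤ max (d x z + d y w) (d x w + d y z)
  exists_between : ∀ x y k, 0 ≤ k → k ≤ d x y → ∃ z, d x z = k ∧ d z y = d x y - k
  even_perimeter : ∀ x y z, Even (d x y + d y z + d x z)
  even_displacement : ∀ (g : G) x, Even (d x (g • x))

namespace IsTreeAction

variable {G V : Type*} [Group G] [MulAction G V] {d : V → V → ℤ}

theorem nonneg (hd : IsTreeAction G d) (x y : V) : 0 ≤ d x y := by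
  have := hd.four_point x x y y
  have h1 := hd.dist_self x
  have h2 := hd.dist_self y
  omega

theorem triangle (hd : IsTreeAction G d) (x y z : V) : d x z ≤ d x y + d y z := by
  have := hd.four_point x z y y
  have h1 := hd.dist_self y
  have h2 := hd.symm y z
  omega

theorem inv_smul_left (hd : IsTreeAction G d) (g : G) (x y : V) :
    d (g⁻¹ • x) y = d x (g • y) := by
  rw [← hd.smul g, smul_inv_smul]

theorem dist_inv_smul (hd : IsTreeAction G d) (g : G) (x : V) :
    d x (g⁻¹ • x) = d x (g • x) := by
  rw [hd.symm, hd.inv_smul_left]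

/-- Twice the Gromov product of `a` and `b` based at `p`. -/
def gromov (d : V → V → ℤ) (p a b : V) : ℤ := d p a + d p b - d a b

theorem gromov_nonneg (hd : IsTreeAction G d) (p a b : V) : 0 ≤ gromov d p a b := by
  have := hd.triangle a p b
  have := hd.symm a p
  unfold gromov
  omega

theorem gromov_comm (hd : IsTreeAction G d) (p a b : V) : gromov d p a b = gromov d p b a := by
  have := hd.symm a b
  unfold gromov
  omega

theorem even_gromov (hd : IsTreeAction G d) (p a b : V) : Even (gromov d p a b) := by
  have h := hd.even_perimeter p a b
  unfold gromov
  grind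

theorem gromov_ultra (hd : IsTreeAction G d) (p a b c : V) :
    min (gromov d p a b) (gromov d p b c) ≤ gromov d p a c := by
  have := hd.four_point p b a c
  have := hd.symm b a
  unfold gromov
  omega

theorem gromov_le_left (hd : IsTreeAction G d) (p a b : V) : gromov d p a b ≤ 2 * d p a := by
  have := hd.triangle p a b
  unfold gromov
  omega

theorem gromov_self (hd : IsTreeAction G d) (p a : V) : gromov d p a a = 2 * d p a := by
  have := hd.dist_self a
  unfold gromov
  omega

/-- The neighbour of `p` in the direction of `a`. -/
theorem exists_direction (hd : IsTreeAction G d) {p a : V} (h : 0 < d p a) :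
    ∃ q, d p q = 1 ∧ ∀ b, 0 < gromov d p a b → d q b = d p b - 1 := by
  obtain ⟨q, hq, hqa⟩ := hd.exists_between p a 1 (by omega) (by omega)
  refine ⟨q, hq, fun b hb => ?_⟩
  have h1 := hd.four_point p a q b
  have h2 := hd.triangle p q b
  have h3 := hd.symm a q
  -- A positive doubled product is even, hence at least 2: the segments to a and b share a full
  -- edge.
  obtain ⟨k, hk⟩ := hd.even_gromov p a b
  unfold gromov at hb hk
  omega

/-- The step towards gp saves one, and the detour from gp to gq costs one. -/
theorem displacement_le_of_left (hd : IsTreeAction G d) {g : G} {p q : V} (hpq : d p q = 1)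
    (h : d q (g • p) = d p (g • p) - 1) : d q (g • q) ≤ d p (g • p) := by
  have h1 := hd.triangle q (g • p) (g • q)
  have h2 := hd.smul g p q
  omega

theorem displacement_le_of_right (hd : IsTreeAction G d) {g : G} {p q : V} (hpq : d p q = 1)
    (h : d q (g⁻¹ • p) = d p (g⁻¹ • p) - 1) : d q (g • q) ≤ d p (g • p) := by
  have := hd.displacement_le_of_left hpq h
  rwa [hd.dist_inv_smul, hd.dist_inv_smul] at this

theorem displacement_le_add (hd : IsTreeAction G d) {g : G} {p q : V} (hpq : d p q = 1) :
    d q (g • q) ≤ d p (g • p) + 2 := by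
  have h1 := hd.triangle q p (g • q)
  have h2 := hd.triangle p (g • p) (g • q)
  have h3 := hd.smul g p q
  have h4 := hd.symm p q
  omega

theorem displacement_le_sub (hd : IsTreeAction G d) {g : G} {p q : V} (hpq : d p q = 1)
    (hp : 0 < d p (g • p)) (h : d q (g • p) = d p (g • p) - 1)
    (h' : d q (g⁻¹ • p) = d p (g⁻¹ • p) - 1) : d q (g • q) ≤ d p (g • p) - 2 := by
  have h1 := hd.four_point p (g • p) q (g • q)
  have h2 := hd.smul g p q
  have h3 := hd.symm (g • p) q
  have h4 : d p (g • q) = d p (g • p) - 1 := by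
    rw [← hd.inv_smul_left, hd.symm, h', hd.dist_inv_smul]
  -- Evenness excludes displacement 1, where g could invert the edge pq and nothing would be gained.
  obtain ⟨k, hk⟩ := hd.even_displacement g p
  omega

/-- A point whose images under `g` and `g⁻¹` lie in different directions realizes the translation
length of `g`. -/
theorem displacement_le_of_gromov_eq_zero (hd : IsTreeAction G d) {g : G} {p : V}
    (h : gromov d p (g • p) (g⁻¹ • p) = 0) (q : V) : d p (g • p) ≤ d q (g • q) := by
  -- By the ultrametric inequality q branches off at p from gp or from g⁻¹p, so one of the paths
  -- from q to these points runs through p.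
  have h1 := hd.gromov_ultra p (g • p) q (g⁻¹ • p)
  have h2 := hd.gromov_nonneg p (g • p) q
  have h3 := hd.gromov_nonneg p q (g⁻¹ • p)
  have h4 := hd.triangle q (g • q) (g • p)
  have h5 := hd.triangle p q (g • q)
  have h6 : d q (g⁻¹ • p) = d p (g • q) := by rw [hd.symm, hd.inv_smul_left]
  have h7 := hd.dist_inv_smul g p
  have h8 := hd.smul g q p
  have h9 := hd.symm p q
  have h10 := hd.symm q (g • p)
  unfold gromov at *
  omega

/-- A fixed-point-free element satisfies `2 (gp | g⁻¹p) < d(p, gp)`. -/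
theorem gromov_lt_of_displacement_pos (hd : IsTreeAction G d) {g : G}
    (hg : ∀ q, 0 < d q (g • q)) (p : V) : gromov d p (g • p) (g⁻¹ • p) < d p (g • p) := by
  by_contra! h
  obtain ⟨k, hk⟩ := hd.even_displacement g p
  have h0 := hd.nonneg p (g • p)
  -- q is the midpoint of [p, g⁻¹p], so gq is the midpoint of [p, gp]. An overlap of at least half
  -- the length makes them coincide, and g fixes q.
  obtain ⟨q, hq, hqp⟩ := hd.exists_between p (g⁻¹ • p) k (by omega)
    (by rw [hd.dist_inv_smul]; omega)
  have h1 := hd.four_point p (g⁻¹ • p) q (g • p)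
  have h2 : d q (g⁻¹ • p) = d (g • q) p := by rw [← hd.inv_smul_left, inv_inv, hd.symm]
  have h3 := hd.smul g q p
  have h4 := hd.symm (g⁻¹ • p) q
  have h5 := hd.symm (g • q) p
  have h6 := hd.dist_inv_smul g p
  have h7 := hd.symm q p
  have h8 := hd.four_point q (g • q) p (g • p)
  have h9 := hg q
  have h10 := hd.symm (g • p) (g⁻¹ • p)
  have h11 := hd.symm (g • q) (g • p)
  unfold gromov at h
  omega

/-- If the axes of `g` and `h` pass through `p`, the length of their overlap in the common
direction is less than the smaller translation length. -/
theorem overlap_lt (hd : IsTreeAction G d) {g h : G} {p : V}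
    (hle : d p (g • p) ≤ d p (h • p))
    (hgh : ∀ q, d p (h • p) - d p (g • p) < d (g • q) (h • q)) :
    gromov d p (g • p) (h • p) + gromov d p (g⁻¹ • p) (h⁻¹ • p) < 2 * d p (g • p) := by
  obtain ⟨j, hj⟩ := hd.even_gromov p (g • p) (h • p)
  obtain ⟨i, hi⟩ := hd.even_gromov p (g⁻¹ • p) (h⁻¹ • p)
  have hg := hd.dist_inv_smul g p
  have hh := hd.dist_inv_smul h p
  have h0 := hd.gromov_nonneg p (g • p) (h • p)
  -- Otherwise gp lies on [p, hp], and q = p violates `hgh`.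
  have h1 : j < d p (g • p) := by
    have := hgh p
    unfold gromov at hj
    omega
  have h2 : i < d p (g • p) := by
    have h3 := hgh (g⁻¹ • p)
    rw [smul_inv_smul, ← hd.inv_smul_left h p (g⁻¹ • p), hd.symm (h⁻¹ • p)] at h3
    unfold gromov at hi
    omega
  by_contra! h3
  -- Since d(p,gp) − j ≤ i, q lies on both [p, g⁻¹p] and [p, h⁻¹p]. Its images gq and hq both lie on
  -- [p, hp], at distances j and d(p,hp) − d(p,gp) + j from p, so they are too close for `hgh`.
  obtain ⟨q, hq, hqa⟩ := hd.exists_between p (g⁻¹ • p) (d p (g • p) - j) (by omega)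
    (by omega)
  have h4 : d q (g⁻¹ • p) = d p (g • q) := by rw [hd.symm, hd.inv_smul_left]
  have h5 : d q (h⁻¹ • p) = d p (h • q) := by rw [hd.symm, hd.inv_smul_left]
  have h6 := hd.smul g p q
  have h7 := hd.smul h p q
  have h8 := hd.four_point p (g⁻¹ • p) q (h⁻¹ • p)
  have h9 := hd.symm (g⁻¹ • p) q
  have h10 := hd.four_point p (g • p) (g • q) (h • p)
  have h11 := hd.four_point (g • q) (h • q) p (h • p)
  have h12 := hd.symm (g • q) p
  have h13 := hd.symm (h • q) p
  have h14 := hd.symm (h • q) (h • p)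
  have h15 := hgh q
  unfold gromov at hi hj h0 h3
  omega

/-! ### Separated half-trees around a base point -/

/-- The half-trees around `a` and `b`, cut off at distance `s` and `t` from `p`, are separated. -/
def Separated (d : V → V → ℤ) (p a : V) (s : ℤ) (b : V) (t : ℤ) : Prop :=
  gromov d p a b ≤ 2 * s - 2 ∧ gromov d p a b ≤ 2 * t - 2

theorem Separated.symm (hd : IsTreeAction G d) {p a b : V} {s t : ℤ}
    (h : Separated d p a s b t) : Separated d p b t a s := by
  rw [Separated, hd.gromov_comm]
  exact ⟨h.2, h.1⟩

/-- The base point minimizes 2d(p,gp) + d(p,hp). The weight 2 gives g priority, so p is on the axis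
of g, and also on that of h unless the axes are disjoint, when p is the foot of the bridge between
them. -/
theorem exists_separated_base_point (hd : IsTreeAction G d) {g h : G}
    (hg : ∀ q, 0 < d q (g • q)) (hh : ∀ q, 0 < d q (h • q)) [Nonempty V] {lg lh : ℤ}
    (hlg : ∀ q, lg ≤ d q (g • q)) (hlg' : ∃ q, d q (g • q) = lg)
    (hlh : ∀ q, lh ≤ d q (h • q)) (hlh' : ∃ q, d q (h • q) = lh) (hl : lg ≤ lh)
    (h₁ : ∀ q, lh - lg < d q ((g * h) • q)) (h₂ : ∀ q, lh - lg < d q ((g⁻¹ * h) • q)) :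
    ∃ (p : V) (s₁ s₂ t₁ t₂ : ℤ), s₁ + s₂ = d p (g • p) + 1 ∧ t₁ + t₂ = d p (h • p) + 1 ∧
      Separated d p (g • p) s₁ (g⁻¹ • p) s₂ ∧ Separated d p (g • p) s₁ (h • p) t₁ ∧
      Separated d p (g • p) s₁ (h⁻¹ • p) t₂ ∧ Separated d p (g⁻¹ • p) s₂ (h • p) t₁ ∧
      Separated d p (g⁻¹ • p) s₂ (h⁻¹ • p) t₂ ∧ Separated d p (h • p) t₁ (h⁻¹ • p) t₂ := by
  obtain ⟨p, hp⟩ : ∃ p, ∀ q, 2 * d p (g • p) + d p (h • p) ≤ 2 * d q (g • q) + d q (h • q) := by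
    let F : V → ℕ := fun q => (2 * d q (g • q) + d q (h • q)).toNat
    refine ⟨Function.argmin F, fun q => ?_⟩
    have : F (Function.argmin F) ≤ F q := Function.argmin_le F q
    simp only [F] at this ⊢
    have := hg q
    have := hh q
    omega
  have hgp := hg p
  have hhp := hh p
  have ig := hd.dist_inv_smul g p
  have ih := hd.dist_inv_smul h p
  -- Off the axis of g, a step towards it would lower the weighted sum by 4 and raise it by at most
  -- 2.
  have hX : gromov d p (g • p) (g⁻¹ • p) = 0 := by
    by_contra hne
    have hpos := lt_of_le_of_ne (hd.gromov_nonneg p (g • p) (g⁻¹ • p)) (Ne.symm hne)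
    obtain ⟨q, hq, hqb⟩ := hd.exists_direction hgp
    have := hd.displacement_le_sub hq hgp (hqb _ (by rw [hd.gromov_self]; omega)) (hqb _ hpos)
    have := hd.displacement_le_add (g := h) hq
    have := hp q
    omega
  -- Off the axis of h, a step towards it lowers d(p,hp) by 2. If the step also headed for gp or
  -- g⁻¹p, d(p,gp) would not grow, against minimality.
  have hY : 0 < gromov d p (h • p) (h⁻¹ • p) →
      ∀ a, a = g • p ∨ a = g⁻¹ • p → gromov d p (h • p) a = 0 := by
    intro hpos a ha
    by_contra hne
    have hpos' := lt_of_le_of_ne (hd.gromov_nonneg p (h • p) a) (Ne.symm hne)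
    obtain ⟨q, hq, hqb⟩ := hd.exists_direction hhp
    have := hd.displacement_le_sub hq hhp (hqb _ (by rw [hd.gromov_self]; omega)) (hqb _ hpos)
    have : d q (g • q) ≤ d p (g • p) := by
      rcases ha with rfl | rfl
      · exact hd.displacement_le_of_left hq (hqb _ hpos')
      · exact hd.displacement_le_of_right hq (hqb _ hpos')
    have := hp q
    omega
  have c1 := hd.gromov_comm p (h • p) (g • p)
  have c2 := hd.gromov_comm p (h • p) (g⁻¹ • p)
  have c3 := hd.gromov_comm p (h⁻¹ • p) (g • p)
  have c4 := hd.gromov_comm p (h⁻¹ • p) (g⁻¹ • p)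
  have c5 := hd.gromov_comm p (h⁻¹ • p) (h • p)
  have n1 := hd.gromov_nonneg p (g • p) (h • p)
  have n2 := hd.gromov_nonneg p (g • p) (h⁻¹ • p)
  have n3 := hd.gromov_nonneg p (g⁻¹ • p) (h • p)
  have n4 := hd.gromov_nonneg p (g⁻¹ • p) (h⁻¹ • p)
  have n5 := hd.gromov_nonneg p (h • p) (h⁻¹ • p)
  have u1 := hd.gromov_ultra p (h • p) (h⁻¹ • p) (g • p)
  have u2 := hd.gromov_ultra p (h • p) (h⁻¹ • p) (g⁻¹ • p)
  obtain ⟨k, hk⟩ := hd.even_displacement h p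
  by_cases hY0 : gromov d p (h • p) (h⁻¹ • p) = 0
  · have u3 := hd.gromov_ultra p (h • p) (g • p) (h⁻¹ • p)
    have u4 := hd.gromov_ultra p (h • p) (g⁻¹ • p) (h⁻¹ • p)
    have u5 := hd.gromov_ultra p (g • p) (h • p) (g⁻¹ • p)
    have u6 := hd.gromov_ultra p (g • p) (h⁻¹ • p) (g⁻¹ • p)
    obtain ⟨qg, hqg⟩ := hlg'
    obtain ⟨qh, hqh⟩ := hlh'
    have eg := hd.displacement_le_of_gromov_eq_zero hX qg
    have eh := hd.displacement_le_of_gromov_eq_zero hY0 qh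
    have eg' := hlg p
    have eh' := hlh p
    have o1 := hd.overlap_lt (g := g) (h := h) (p := p) (by omega) (fun q => by
      have := h₂ q
      rw [mul_smul, ← hd.inv_smul_left, inv_inv] at this
      omega)
    have o2 := hd.overlap_lt (g := g) (h := h⁻¹) (p := p) (by omega) (fun q => by
      have := h₁ (h⁻¹ • q)
      rw [mul_smul, smul_inv_smul, hd.symm] at this
      omega)
    rw [inv_inv] at o2
    obtain ⟨j, hj⟩ := hd.even_gromov p (g • p) (h • p)
    obtain ⟨i, hi⟩ := hd.even_gromov p (g • p) (h⁻¹ • p)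
    obtain ⟨j', hj'⟩ := hd.even_gromov p (g⁻¹ • p) (h⁻¹ • p)
    obtain ⟨i', hi'⟩ := hd.even_gromov p (g⁻¹ • p) (h • p)
    -- In the first case the axes do not overlap with opposite orientations. The forward half-trees
    -- start at j + 1, just past the forward overlap; the backward cutoffs d(p,gp) − j and d(p,hp) −
    -- j exceed the backward overlap j' because j + j' < d(p,gp) ≤ d(p,hp). The second case
    -- exchanges h and h⁻¹.
    by_cases hc : gromov d p (g • p) (h⁻¹ • p) = 0 ∧ gromov d p (g⁻¹ • p) (h • p) = 0
    · refine ⟨p, j + 1, d p (g • p) - j, j + 1, d p (h • p) - j, ?_⟩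
      unfold Separated
      omega
    · refine ⟨p, i + 1, d p (g • p) - i, d p (h • p) - i, i + 1, ?_⟩
      unfold Separated
      omega
  · have hY1 := hY (by omega) _ (.inl rfl)
    have hY2 := hY (by omega) _ (.inr rfl)
    have hlt := hd.gromov_lt_of_displacement_pos hh p
    obtain ⟨e, he⟩ := hd.even_gromov p (h • p) (h⁻¹ • p)
    -- All products between a g-direction and an h-direction vanish. Only the overlap e of [p, hp]
    -- and [p, h⁻¹p] remains, and e < k since h has no fixed point.
    refine ⟨p, 1, d p (g • p), k, k + 1, ?_⟩
    unfold Separated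
    omega

/-- The half-tree of points whose projection to the segment from `p` to `a` has distance at least
`s` from `p`. -/
def halfTree (d : V → V → ℤ) (p a : V) (s : ℤ) : Set V := {x | 2 * s ≤ gromov d p x a}

/-- The segments from p to u and v part at distance at most min(s,t) − 1, while u and v are at
distance at least s and t. A gap of 2, not mere disjointness, keeps any edge from joining the
half-trees. -/
theorem one_lt_dist_of_separated (hd : IsTreeAction G d) {p a b : V} {s t : ℤ}
    (h : Separated d p a s b t) {u v : V} (hu : u ∈ halfTree d p a s)
    (hv : v ∈ halfTree d p b t) : 1 < d u v := by
  have h1 := hd.gromov_ultra p a u b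
  have h2 := hd.gromov_ultra p u v b
  have h3 := hd.gromov_le_left p u a
  have h4 := hd.gromov_le_left p v b
  have h5 := hd.gromov_comm p a u
  unfold halfTree at hu hv
  simp only [Set.mem_ofPred_eq] at hu hv
  have h6 : gromov d p u v = d p u + d p v - d u v := rfl
  unfold Separated at h
  omega

/-- The doubled products of x with g⁻¹p and of gx with gp add up to 2d(p,gp). The former, being even
and below 2t, is at most 2t − 2; this accounts for the 1 in `hst`. -/
theorem smul_halfTree_compl (hd : IsTreeAction G d) {g : G} {p : V} {s t : ℤ}
    (hst : s + t = d p (g • p) + 1) {x : V} (hx : x ∉ halfTree d p (g⁻¹ • p) t) :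
    g • x ∈ halfTree d p (g • p) s := by
  unfold halfTree at *
  simp only [Set.mem_ofPred_eq] at *
  have h1 : d x (g⁻¹ • p) = d p (g • x) := by rw [hd.symm, hd.inv_smul_left]
  have h2 := hd.dist_inv_smul g p
  have h3 := hd.smul g p x
  have h4 := hd.symm (g • x) (g • p)
  obtain ⟨k, hk⟩ := hd.even_gromov p x (g⁻¹ • p)
  unfold gromov at *
  omega

theorem base_notMem_halfTree (hd : IsTreeAction G d) {p a : V} {s : ℤ} (hs : 1 ≤ s) :
    p ∉ halfTree d p a s := by
  have := hd.gromov_le_left p p a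
  have := hd.dist_self p
  simp only [halfTree, Set.mem_ofPred_eq]
  omega

/-- The index (i, b) is a letter of the free group: `true` for the i-th generator, `false` for its
inverse. -/
theorem exists_pingPong_sets (hd : IsTreeAction G d) {g h : G}
    (hg : ∀ q, 0 < d q (g • q)) (hh : ∀ q, 0 < d q (h • q)) [Nonempty V] {lg lh : ℤ}
    (hlg : ∀ q, lg ≤ d q (g • q)) (hlg' : ∃ q, d q (g • q) = lg)
    (hlh : ∀ q, lh ≤ d q (h • q)) (hlh' : ∃ q, d q (h • q) = lh) (hl : lg ≤ lh)
    (h₁ : ∀ q, lh - lg < d q ((g * h) • q)) (h₂ : ∀ q, lh - lg < d q ((g⁻¹ * h) • q)) :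
    ∃ (p : V) (S : Fin 2 × Bool → Set V), (∀ i, p ∉ S i) ∧ (∀ i, (S i).Nonempty) ∧
      (∀ i j, i ≠ j → ∀ u ∈ S i, ∀ v ∈ S j, 1 < d u v) ∧
      (∀ i x, x ∉ S (i, false) → ![g, h] i • x ∈ S (i, true)) ∧
      (∀ i x, x ∉ S (i, true) → (![g, h] i)⁻¹ • x ∈ S (i, false)) := by
  obtain ⟨p, s₁, s₂, t₁, t₂, hs, ht, h12, h13, h14, h23, h24, h34⟩ :=
    hd.exists_separated_base_point hg hh hlg hlg' hlh hlh' hl h₁ h₂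
  let a : Fin 2 × Bool → V := fun i => if i.2 then ![g, h] i.1 • p else (![g, h] i.1)⁻¹ • p
  let c : Fin 2 × Bool → ℤ := fun i => if i.2 then ![s₁, t₁] i.1 else ![s₂, t₂] i.1
  have hsep : ∀ i j, i ≠ j → Separated d p (a i) (c i) (a j) (c j) := by
    simp only [Prod.forall, Fin.forall_fin_two, Bool.forall_bool]
    exact ⟨⟨⟨⟨fun h => absurd rfl h, fun _ => h12.symm hd⟩, fun _ => h24, fun _ => h23⟩,
      ⟨fun _ => h12, fun h => absurd rfl h⟩, fun _ => h14, fun _ => h13⟩,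
      ⟨⟨fun _ => h24.symm hd, fun _ => h14.symm hd⟩, fun h => absurd rfl h, fun _ => h34.symm hd⟩,
      ⟨fun _ => h23.symm hd, fun _ => h13.symm hd⟩, fun _ => h34, fun h => absurd rfl h⟩
  have hc : ∀ i, 1 ≤ c i := by
    intro i
    have h1 := (hsep i (i.1, !i.2) (fun h => by simpa using congrArg Prod.snd h)).1
    have h2 := hd.gromov_nonneg p (a i) (a (i.1, !i.2))
    omega
  have hsum : ∀ i, c (i, true) + c (i, false) = d p (![g, h] i • p) + 1 :=
    Fin.forall_fin_two.mpr ⟨hs, ht⟩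
  refine ⟨p, fun i => halfTree d p (a i) (c i), fun i => hd.base_notMem_halfTree (hc i), ?_,
    fun i j hij u hu v hv => hd.one_lt_dist_of_separated (hsep i j hij) hu hv,
    fun i x hx => hd.smul_halfTree_compl (hsum i) hx, fun i x hx => ?_⟩
  · rintro ⟨i, b⟩
    refine ⟨a (i, b), ?_⟩
    have h1 := hsum i
    have h2 := hc (i, true)
    have h3 := hc (i, false)
    have h4 := hd.dist_inv_smul (![g, h] i) p
    have h5 : d p (a (i, b)) = d p (![g, h] i • p) := by
      cases b
      · exact h4
      · rfl
    have h6 : c (i, b) ≤ d p (![g, h] i • p) := by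
      cases b <;> omega
    change 2 * c (i, b) ≤ gromov d p (a (i, b)) (a (i, b))
    rw [hd.gromov_self, h5]
    omega
  · refine hd.smul_halfTree_compl (t := c (i, true)) ?_ ?_
    · have h4 := hd.dist_inv_smul (![g, h] i) p
      have h1 := hsum i
      change c (i, false) + c (i, true) = d p ((![g, h] i)⁻¹ • p) + 1
      omega
    · rw [inv_inv]
      exact hx

end IsTreeAction

/-! ### Ping-pong: freeness and discreteness -/

section FreeDiscrete

variable {G V : Type*} [Group G] [MulAction G V]

/-- A letter sends everything outside the set of its inverse into its own set, and in a reduced word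
the following letter is never that inverse. -/
theorem FreeGroup.lift_smul_mem_of_pingPong {ι : Type*} {a : ι → G} {S : ι × Bool → Set V}
    {p : V} (hS : Pairwise (Function.onFun Disjoint S)) (hp : ∀ i, p ∉ S i)
    (ha : ∀ i x, x ∉ S (i, false) → a i • x ∈ S (i, true))
    (ha' : ∀ i x, x ∉ S (i, true) → (a i)⁻¹ • x ∈ S (i, false))
    (i : ι × Bool) (L : List (ι × Bool)) (h : FreeGroup.IsReduced (i :: L)) :
    FreeGroup.lift a (FreeGroup.mk (i :: L)) • p ∈ S i := by
  have key : ∀ (i : ι × Bool) (x : V), x ∉ S (i.1, !i.2) →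
      FreeGroup.lift a (FreeGroup.mk [i]) • x ∈ S i := by
    rintro ⟨i, _ | _⟩ x hx
    · simpa using ha' i x hx
    · simpa using ha i x hx
  induction L generalizing i with
  | nil => exact key i p (hp _)
  | cons j L ih =>
    rw [FreeGroup.isReduced_cons_cons] at h
    rw [← List.singleton_append, ← FreeGroup.mul_mk, _root_.map_mul, mul_smul]
    refine key i _ fun hmem => ?_
    have hne : j ≠ (i.1, !i.2) := by
      rintro rfl
      simpa using h.1 rfl
    exact (Set.disjoint_left.mp (hS hne)) (ih j h.2) hmem

theorem FreeGroup.eq_one_of_pingPong_of_lift_smul_eq {ι : Type*} {a : ι → G}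
    {S : ι × Bool → Set V} {p : V} (hS : Pairwise (Function.onFun Disjoint S))
    (hp : ∀ i, p ∉ S i) (ha : ∀ i x, x ∉ S (i, false) → a i • x ∈ S (i, true))
    (ha' : ∀ i x, x ∉ S (i, true) → (a i)⁻¹ • x ∈ S (i, false)) {w : FreeGroup ι}
    (h : FreeGroup.lift a w • p = p) : w = 1 := by
  classical
  rcases hw : w.toWord with _ | ⟨i, L⟩
  · exact FreeGroup.toWord_eq_nil_iff.mp hw
  · have := FreeGroup.lift_smul_mem_of_pingPong hS hp ha ha' i L
      (hw ▸ FreeGroup.isReduced_toWord)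
    rw [← hw, FreeGroup.mk_toWord, h] at this
    exact absurd this (hp i)

/-- The hypothesis makes the lift injective and the stabilizer of p in its image trivial; that
stabilizer is open. -/
theorem isDiscreteFreeRankTwo_of_forall_lift_smul_eq [TopologicalSpace G] [IsTopologicalGroup G]
    {X Y : G} {p : V} (hp : IsOpen (MulAction.stabilizer G p : Set G))
    (h : ∀ w : FreeGroup (Fin 2), FreeGroup.lift ![X, Y] w • p = p → w = 1) :
    IsDiscreteFreeRankTwo (Subgroup.closure {X, Y}) := by
  have hr : (FreeGroup.lift ![X, Y]).range = Subgroup.closure {X, Y} := by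
    rw [FreeGroup.range_lift_eq_closure]
    simp [Set.pair_comm]
  rw [← hr]
  constructor
  · rw [discreteTopology_iff_isOpen_singleton_one]
    convert! hp.preimage (continuous_subtype_val (p := (· ∈ (FreeGroup.lift ![X, Y]).range)))
    ext ⟨_, w, rfl⟩
    simp only [Set.mem_singleton_iff, Set.mem_preimage, SetLike.mem_coe,
      MulAction.mem_stabilizer_iff]
    constructor
    · intro hw
      rw [Subtype.ext_iff] at hw
      simp only [Subgroup.coe_one] at hw
      rw [hw, one_smul]
    · intro hw
      have := h w hw
      subst this
      ext
      simp
  · refine ⟨(MonoidHom.ofInjective ((injective_iff_map_eq_one _).mpr fun w hw => h w ?_)).symm⟩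
    rw [hw, one_smul]

end FreeDiscrete

namespace BruhatTits

/-! ### From sets of vertices to closed sets of the realization -/

section Realization

variable {V : Type*} {T : SimpleGraph V}

open scoped Classical in
theorem sum_edgePoint (u v : V) (t : ℝ) (F : Finset V) :
    ∑ x ∈ F, edgePoint u v t x = (if u ∈ F then 1 - t else 0) + if v ∈ F then t else 0 := by
  simp [edgePoint, Finset.sum_add_distrib, Pi.single_apply]

theorem Realization.sum_le_one (f : Realization T) (F : Finset V) : ∑ x ∈ F, f.1 x ≤ 1 := by
  classical
  obtain ⟨f, u, v, t, -, ht, rfl⟩ := f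
  simp only [sum_edgePoint]
  obtain ⟨h0, h1⟩ := ht
  split_ifs <;> linarith

/-- The point of the realization given by a vertex. -/
def Realization.ofVertex (T : SimpleGraph V) (v : V) : Realization T :=
  ⟨edgePoint v v 0, v, v, 0, .inl rfl, by simp, rfl⟩

/-- The points of the realization which put at most half of their mass outside `S`. -/
def Realization.hull (T : SimpleGraph V) (S : Set V) : Set (Realization T) :=
  {f | ∀ F : Finset V, (∀ v ∈ F, v ∉ S) → ∑ x ∈ F, f.1 x ≤ 1 / 2}

theorem Realization.isClosed_hull (S : Set V) : IsClosed (hull T S) := by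
  have : hull T S = ⋂ (F : Finset V) (_ : ∀ v ∈ F, v ∉ S),
      {f : Realization T | ∑ x ∈ F, f.1 x ≤ 1 / 2} := by
    ext f
    simp [hull]
  rw [this]
  refine isClosed_iInter fun F => isClosed_iInter fun _ => isClosed_le ?_ continuous_const
  exact continuous_finsetSum _ fun x _ => (continuous_apply x).comp continuous_subtype_val

theorem Realization.ofVertex_mem_hull {S : Set V} {v : V} :
    ofVertex T v ∈ hull T S ↔ v ∈ S := by
  classical
  constructor
  · intro h
    by_contra hv
    have := h {v} (by simpa using hv)
    simp only [ofVertex, sum_edgePoint] at this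
    norm_num at this
  · intro h F hF
    have : v ∉ F := fun hv => hF v hv h
    simp only [ofVertex, sum_edgePoint]
    simp [this]

/-- A point in the hull of a set has an endpoint of its edge there, since otherwise its whole mass 1
would lie outside. -/
theorem Realization.disjoint_hull {S S' : Set V}
    (h : ∀ u ∈ S, ∀ v ∈ S', u ≠ v ∧ ¬ T.Adj u v) : Disjoint (hull T S) (hull T S') := by
  classical
  have key : ∀ {u v : V} {t : ℝ} {R : Set V} (hf : ∃ (u' v' : V) (t' : ℝ),
      (u' = v' ∨ T.Adj u' v') ∧ t' ∈ Set.Icc (0 : ℝ) 1 ∧ edgePoint u v t = edgePoint u' v' t'),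
      (⟨edgePoint u v t, hf⟩ : Realization T) ∈ hull T R → u ∈ R ∨ v ∈ R := by
    intro u v t R hf hmem
    by_contra! hne
    have := hmem {u, v} (by simp [hne])
    simp only [sum_edgePoint] at this
    norm_num at this
  rw [Set.disjoint_left]
  rintro ⟨f, u, v, t, huv, ht, rfl⟩ h1 h2
  have e1 : u ∉ S ∨ u ∉ S' := by
    by_contra! hc
    exact (h u hc.1 u hc.2).1 rfl
  have e2 : v ∉ S ∨ v ∉ S' := by
    by_contra! hc
    exact (h v hc.1 v hc.2).1 rfl
  have e3 : ¬ (u ∈ S ∧ v ∈ S') := fun hc =>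
    huv.elim (h u hc.1 v hc.2).1 (h u hc.1 v hc.2).2
  have e4 : ¬ (v ∈ S ∧ u ∈ S') := fun hc =>
    huv.elim (fun e => (h v hc.1 u hc.2).1 e.symm) fun e => (h v hc.1 u hc.2).2 e.symm
  have e5 := key _ h1
  have e6 := key _ h2
  tauto

variable {K : Type*} [Field K] [ValuativeRel K]

theorem Realization.smul_val (g : SL(2, K)) (f : Realization (tree K)) (x : Vertex K) :
    (g • f).1 x = f.1 (g⁻¹ • x) := rfl

/-- A point off the hull has more than half of its mass outside S, and g carries this mass into S'.
Cutting edges at midpoints makes the two conditions match. -/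
theorem Realization.smul_hull_compl_subset {g : SL(2, K)} {S S' : Set (Vertex K)}
    (h : ∀ x, x ∉ S → g • x ∈ S') : g • (hull (tree K) S)ᶜ ⊆ hull (tree K) S' := by
  classical
  rintro _ ⟨f, hf, rfl⟩ F hF
  simp only [hull, Set.mem_compl_iff, Set.mem_ofPred_eq] at hf
  push Not at hf
  obtain ⟨F', hF', hlt⟩ := hf
  have hdisj : Disjoint F' (F.image (g⁻¹ • ·)) := by
    rw [Finset.disjoint_left]
    intro x hx hx'
    obtain ⟨y, hy, rfl⟩ := Finset.mem_image.mp hx'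
    have := h _ (hF' _ hx)
    simp only [smul_inv_smul] at this
    exact hF y hy this
  have := f.sum_le_one (F' ∪ F.image (g⁻¹ • ·))
  rw [Finset.sum_union hdisj,
    Finset.sum_image fun x _ y _ e => MulAction.injective g⁻¹ e] at this
  simp only [Realization.smul_val]
  linarith

/-- Open stabilizers make g⁻¹ • x locally constant in g, so near a given g each coordinate of g • f
is a fixed coordinate of f. -/
theorem Realization.continuousSMul [TopologicalSpace K] [IsTopologicalRing K]
    (h : ∀ x : Vertex K, IsOpen (MulAction.stabilizer SL(2, K) x : Set SL(2, K))) :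
    ContinuousSMul SL(2, K) (Realization (tree K)) where
  continuous_smul := by
    refine Continuous.subtype_mk (continuous_pi fun x => ?_) _
    rw [continuous_iff_continuousAt]
    rintro ⟨g, f⟩
    have hc : ContinuousAt
        (fun q : SL(2, K) × Realization (tree K) => q.2.1 (g⁻¹ • x)) (g, f) :=
      (((continuous_apply (g⁻¹ • x)).comp continuous_subtype_val).comp
        continuous_snd).continuousAt
    refine hc.congr ?_
    have hopen : IsOpen {q : SL(2, K) × Realization (tree K) |
        q.1 * g⁻¹ ∈ MulAction.stabilizer SL(2, K) x} :=
      (h x).preimage (by fun_prop : Continuous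
        fun q : SL(2, K) × Realization (tree K) => q.1 * g⁻¹)
    filter_upwards [hopen.mem_nhds (by simp)] with q hq
    have : q.1⁻¹ • x = g⁻¹ • x := by
      rw [inv_smul_eq_iff, ← mul_smul]
      exact (MulAction.mem_stabilizer_iff.mp hq).symm
    rw [← this]

end Realization

/-! ### Determinants and elementary divisors of lattices -/

section Lattices

open ValuativeRel WithZero

variable {K : Type*} [Field K]

/-- The determinant of two vectors in `K²`. -/
def wedge (x y : Fin 2 → K) : K := x 0 * y 1 - x 1 * y 0

@[simp] theorem wedge_self (x : Fin 2 → K) : wedge x x = 0 := by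
  simp only [wedge]
  ring

theorem wedge_smul_left (a : K) (x y : Fin 2 → K) : wedge (a • x) y = a * wedge x y := by
  simp only [wedge, Pi.smul_apply, smul_eq_mul]
  ring

theorem wedge_smul_right (a : K) (x y : Fin 2 → K) : wedge x (a • y) = a * wedge x y := by
  simp only [wedge, Pi.smul_apply, smul_eq_mul]
  ring

theorem wedge_add_left (x y z : Fin 2 → K) : wedge (x + y) z = wedge x z + wedge y z := by
  simp only [wedge, Pi.add_apply]
  ring

theorem wedge_add_right (x y z : Fin 2 → K) : wedge x (y + z) = wedge x y + wedge x z := by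
  simp only [wedge, Pi.add_apply]
  ring

theorem wedge_comm (x y : Fin 2 → K) : wedge x y = -wedge y x := by
  simp only [wedge]
  ring

/-- The Plücker relation, from which the four-point inequality comes. -/
theorem wedge_mul_wedge (x y z w : Fin 2 → K) :
    wedge x y * wedge z w = wedge x z * wedge y w - wedge x w * wedge y z := by
  simp only [wedge]
  ring

theorem eq_combination_of_wedge_ne_zero {e f : Fin 2 → K} (h : wedge e f ≠ 0) (x : Fin 2 → K) :
    x = (wedge x f / wedge e f) • e + (wedge e x / wedge e f) • f := by
  funext i
  simp only [Pi.add_apply, Pi.smul_apply, smul_eq_mul]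
  field_simp
  simp only [wedge]
  fin_cases i <;> simp <;> ring

theorem wedge_mulVec (g : SL(2, K)) (x y : Fin 2 → K) :
    wedge (Matrix.mulVec (g : Matrix (Fin 2) (Fin 2) K) x)
      (Matrix.mulVec (g : Matrix (Fin 2) (Fin 2) K) y) = wedge x y := by
  have := g.det_coe
  rw [Matrix.det_fin_two] at this
  simp only [wedge, Matrix.mulVec, dotProduct, Fin.sum_univ_two]
  linear_combination (x 0 * y 1 - x 1 * y 0) * this

variable [ValuativeRel K]

theorem span_pair_le_iff {e f : Fin 2 → K} {L : Submodule 𝒪[K] (Fin 2 → K)} :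
    Submodule.span 𝒪[K] {e, f} ≤ L ↔ e ∈ L ∧ f ∈ L := by
  rw [Submodule.span_le, Set.insert_subset_iff, Set.singleton_subset_iff]
  rfl

theorem isLattice_span_pair {e f : Fin 2 → K} (h : wedge e f ≠ 0) :
    Submodule.IsLattice K (Submodule.span 𝒪[K] {e, f}) where
  fg := Submodule.fg_span (by simp)
  span_eq_top := by
    rw [Submodule.span_span_of_tower, eq_top_iff]
    intro x _
    rw [Submodule.mem_span_pair]
    exact ⟨_, _, (eq_combination_of_wedge_ne_zero h x).symm⟩

variable [TopologicalSpace K] [IsNonarchimedeanLocalField K]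

variable (K) in
/-- The valuation of a local field, normalized to take values in `ℤᵐ⁰`. -/
def intValuation : Valuation K ℤᵐ⁰ :=
  (valuation K).map (MonoidWithZeroHom.ofClass
    (IsNonarchimedeanLocalField.valueGroupWithZeroIsoInt K))
    (IsNonarchimedeanLocalField.valueGroupWithZeroIsoInt K).strictMono.monotone

theorem intValuation_le_iff {x y : K} :
    intValuation K x ≤ intValuation K y ↔ valuation K x ≤ valuation K y :=
  (IsNonarchimedeanLocalField.valueGroupWithZeroIsoInt K).strictMono.le_iff_le

theorem mem_integer_iff {x : K} : x ∈ 𝒪[K] ↔ intValuation K x ≤ 1 := by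
  rw [← map_one (intValuation K), intValuation_le_iff, map_one, Valuation.mem_integer_iff]

theorem intValuation_surjective : Function.Surjective (intValuation K) :=
  (EquivLike.surjective (IsNonarchimedeanLocalField.valueGroupWithZeroIsoInt K)).comp
    ValuativeRel.valuation_surjective

variable (K) in
theorem exists_uniformizer : ∃ ϖ : K, intValuation K ϖ = exp (-1) := intValuation_surjective _

variable (K) in
/-- An element of valuation one. -/
def unif : K := (exists_uniformizer K).choose

theorem intValuation_unif : intValuation K (unif K) = exp (-1) := (exists_uniformizer K).choose_spec

theorem unif_ne_zero : unif K ≠ 0 := by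
  rw [← (intValuation K).ne_zero_iff, intValuation_unif]
  exact exp_ne_zero

theorem intValuation_unif_pow (n : ℕ) : intValuation K (unif K ^ n) = exp (-n : ℤ) := by
  rw [map_pow, intValuation_unif, ← exp_nsmul]
  simp

theorem mem_span_pair {e f x : Fin 2 → K} :
    x ∈ Submodule.span 𝒪[K] {e, f} ↔
      ∃ a b : K, intValuation K a ≤ 1 ∧ intValuation K b ≤ 1 ∧ a • e + b • f = x := by
  rw [Submodule.mem_span_pair]
  constructor
  · rintro ⟨a, b, rfl⟩
    exact ⟨a, b, mem_integer_iff.mp a.2, mem_integer_iff.mp b.2, rfl⟩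
  · rintro ⟨a, b, ha, hb, rfl⟩
    exact ⟨⟨a, mem_integer_iff.mpr ha⟩, ⟨b, mem_integer_iff.mpr hb⟩, rfl⟩

theorem mem_span_pair_iff_wedge {e f x : Fin 2 → K} (h : wedge e f ≠ 0) :
    x ∈ Submodule.span 𝒪[K] {e, f} ↔
      intValuation K (wedge x f) ≤ intValuation K (wedge e f) ∧
        intValuation K (wedge e x) ≤ intValuation K (wedge e f) := by
  have h0 : 0 < intValuation K (wedge e f) := zero_lt_iff.mpr ((intValuation K).ne_zero_iff.mpr h)
  rw [mem_span_pair]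
  constructor
  · rintro ⟨a, b, ha, hb, rfl⟩
    simp only [wedge_add_left, wedge_add_right, wedge_smul_left, wedge_smul_right, wedge_self,
      mul_zero, add_zero, zero_add, map_mul]
    exact ⟨mul_le_of_le_one_left' ha, mul_le_of_le_one_left' hb⟩
  · rintro ⟨h1, h2⟩
    refine ⟨wedge x f / wedge e f, wedge e x / wedge e f, ?_, ?_,
      (eq_combination_of_wedge_ne_zero h x).symm⟩
    · rw [map_div₀]
      exact div_le_one_of_le₀ h1 zero_le
    · rw [map_div₀]
      exact div_le_one_of_le₀ h2 zero_le

/-- The lattice with basis `e`, `f`. -/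
def OLattice.ofPair {e f : Fin 2 → K} (h : wedge e f ≠ 0) : OLattice K :=
  ⟨Submodule.span 𝒪[K] {e, f}, isLattice_span_pair h⟩

theorem OLattice.exists_eq_span (L : OLattice K) :
    ∃ e f : Fin 2 → K, wedge e f ≠ 0 ∧ L.1 = Submodule.span 𝒪[K] {e, f} := by
  have := L.2
  let b := Module.finBasisOfFinrankEq 𝒪[K] L.1
    ((Submodule.IsLattice.finrank_of_pi (ι := Fin 2) K L.1).trans (Fintype.card_fin 2))
  have hli := (b.extendOfIsLattice K).linearIndependent
  rw [show ⇑(b.extendOfIsLattice K) = ![b.extendOfIsLattice K 0, b.extendOfIsLattice K 1] by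
    ext i : 1; fin_cases i <;> rfl, LinearIndependent.pair_iff] at hli
  simp only [Module.Basis.extendOfIsLattice_apply] at hli
  refine ⟨b 0, b 1, fun h0 => ?_, ?_⟩
  -- A vanishing determinant gives a linear relation from each coordinate; independence then makes
  -- both coordinates of `b 0` zero.
  · have h1 := hli (-((b 1 : Fin 2 → K) 0)) ((b 0 : Fin 2 → K) 0) (by
      funext i
      simp only [wedge] at h0
      fin_cases i
      · simp
        ring
      · simp
        linear_combination h0)
    have h2 := hli (-((b 1 : Fin 2 → K) 1)) ((b 0 : Fin 2 → K) 1) (by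
      funext i
      simp only [wedge] at h0
      fin_cases i
      · simp
        linear_combination -h0
      · simp
        ring)
    have h3 := hli 1 0 (by
      funext i
      fin_cases i
      · simp [h1.2]
      · simp [h2.2])
    exact one_ne_zero h3.1
  · have := congrArg (Submodule.map L.1.subtype) b.span_eq
    rw [Submodule.map_top, Submodule.range_subtype, Submodule.map_span, ← Set.range_comp] at this
    refine this.symm.trans (congrArg _ ?_)
    ext x
    simp [Fin.exists_fin_two, eq_comm]

/-- One elimination step with pivot α, an entry of largest absolute value in the matrix expressing
m₁, m₂ in b₁, b₂. Here η is the determinant of that matrix divided by α², and ϖⁿ is η up to a unit.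
-/
theorem exists_normalForm_aux {b₁ b₂ m₂ : Fin 2 → K} (hb : wedge b₁ b₂ ≠ 0) {α β γ δ : K}
    (hα : α ≠ 0) (hβ : intValuation K β ≤ intValuation K α)
    (hγ : intValuation K γ ≤ intValuation K α) (hδ : intValuation K δ ≤ intValuation K α)
    {m₁ : Fin 2 → K} (h₁ : m₁ = α • b₁ + β • b₂) (h₂ : m₂ = γ • b₁ + δ • b₂)
    (hm : wedge m₁ m₂ ≠ 0) :
    ∃ (e f : Fin 2 → K) (n : ℕ) (c : K), wedge e f ≠ 0 ∧ c ≠ 0 ∧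
      Submodule.span 𝒪[K] {b₁, b₂} = Submodule.span 𝒪[K] {e, f} ∧
      Submodule.span 𝒪[K] {m₁, m₂} = Submodule.span 𝒪[K] {c • e, (c * unif K ^ n) • f} := by
  have hle : ∀ {x : K}, intValuation K x ≤ intValuation K α → intValuation K (x / α) ≤ 1 := by
    intro x hx
    rw [map_div₀]
    exact div_le_one_of_le₀ hx zero_le
  set η : K := δ / α - γ / α * (β / α) with hη
  have hη1 : intValuation K η ≤ 1 := by
    refine (Valuation.map_sub _ _ _).trans (max_le (hle hδ) ?_)
    rw [map_mul]
    exact mul_le_one' (hle hγ) (hle hβ)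
  have hη0 : η ≠ 0 := by
    intro h0
    apply hm
    have : wedge m₁ m₂ = α ^ 2 * η * wedge b₁ b₂ := by
      rw [h₁, h₂, hη]
      simp only [wedge_add_left, wedge_add_right, wedge_smul_left, wedge_smul_right, wedge_self,
        wedge_comm b₂ b₁]
      field_simp
      ring
    rw [this, h0]
    ring
  obtain ⟨n, hn⟩ : ∃ n : ℕ, intValuation K η = exp (-n : ℤ) := by
    have hv : intValuation K η ≠ 0 := (intValuation K).ne_zero_iff.mpr hη0
    refine ⟨(-log (intValuation K η)).toNat, ?_⟩
    have := (log_le_log hv one_ne_zero).mpr hη1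
    rw [log_one] at this
    rw [Int.toNat_of_nonneg (by omega), neg_neg, exp_log hv]
  have hu0 : unif K ^ n ≠ 0 := pow_ne_zero _ unif_ne_zero
  have hηu : intValuation K η = intValuation K (unif K ^ n) := by rw [hn, intValuation_unif_pow]
  have hvu : intValuation K (unif K ^ n) ≠ 0 := (intValuation K).ne_zero_iff.mpr hu0
  have one_le : intValuation K (1 : K) ≤ 1 := (map_one _).le
  have zero_le' : intValuation K (0 : K) ≤ 1 := by simp
  have neg_le : ∀ {x : K}, intValuation K x ≤ 1 → intValuation K (-x) ≤ 1 := by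
    intro x hx
    rwa [Valuation.map_neg]
  refine ⟨b₁ + (β / α) • b₂, b₂, n, α, ?_, hα, ?_, ?_⟩
  · simpa [wedge_add_left, wedge_smul_left] using hb
  · apply le_antisymm <;> rw [span_pair_le_iff] <;> constructor <;> rw [mem_span_pair]
    · refine ⟨1, -(β / α), one_le, neg_le (hle hβ), ?_⟩
      module
    · exact ⟨0, 1, zero_le', one_le, by module⟩
    · exact ⟨1, β / α, one_le, hle hβ, by module⟩
    · exact ⟨0, 1, zero_le', one_le, by module⟩
  · have e1 : α • (b₁ + (β / α) • b₂) = m₁ := by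
      rw [h₁, smul_add, smul_smul, mul_div_cancel₀ _ hα]
    have e2 : m₂ = (γ / α) • m₁ + (α * η) • b₂ := by
      rw [h₁, h₂, hη, smul_add, smul_smul, smul_smul, add_assoc, ← add_smul]
      congr 2 <;> field_simp
      ring
    rw [e1]
    apply le_antisymm <;> rw [span_pair_le_iff] <;> constructor <;> rw [mem_span_pair]
    · exact ⟨1, 0, one_le, zero_le', by module⟩
    · refine ⟨γ / α, η / unif K ^ n, hle hγ, ?_, ?_⟩
      · rw [map_div₀, hηu, div_self hvu]
      · rw [e2, smul_smul]
        congr 2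
        field_simp
    · exact ⟨1, 0, one_le, zero_le', by module⟩
    · refine ⟨-(γ / α) * (unif K ^ n / η), unif K ^ n / η, ?_, ?_, ?_⟩
      · rw [map_mul, map_div₀ _ _ η, hηu, div_self hvu, mul_one]
        exact neg_le (hle hγ)
      · rw [map_div₀, hηu, div_self hvu]
      · rw [e2, smul_add, smul_smul, smul_smul, ← add_assoc, ← add_smul]
        have : -(γ / α) * (unif K ^ n / η) + unif K ^ n / η * (γ / α) = 0 := by ring
        rw [this, zero_smul, zero_add]
        congr 1
        field_simp

/-- Two lattices have bases `e, f` and `c e, c ϖⁿ f`. -/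
theorem OLattice.exists_normalForm (L M : OLattice K) :
    ∃ (e f : Fin 2 → K) (n : ℕ) (c : K), wedge e f ≠ 0 ∧ c ≠ 0 ∧
      L.1 = Submodule.span 𝒪[K] {e, f} ∧
      M.1 = Submodule.span 𝒪[K] {c • e, (c * unif K ^ n) • f} := by
  obtain ⟨b₁, b₂, hb, hL⟩ := L.exists_eq_span
  obtain ⟨m₁, m₂, hm, hM⟩ := M.exists_eq_span
  rw [hL, hM]
  have h₁ := eq_combination_of_wedge_ne_zero hb m₁
  have h₂ := eq_combination_of_wedge_ne_zero hb m₂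
  set α := wedge m₁ b₂ / wedge b₁ b₂
  set β := wedge b₁ m₁ / wedge b₁ b₂
  set γ := wedge m₂ b₂ / wedge b₁ b₂
  set δ := wedge b₁ m₂ / wedge b₁ b₂
  have hb' : wedge b₂ b₁ ≠ 0 := by rwa [wedge_comm, neg_ne_zero]
  have hm' : wedge m₂ m₁ ≠ 0 := by rwa [wedge_comm, neg_ne_zero]
  have h₁' := h₁.trans (add_comm _ _)
  have h₂' := h₂.trans (add_comm _ _)
  have hne : ∀ {a b c d : K} {x y : Fin 2 → K}, wedge x y ≠ 0 → x = a • b₁ + b • b₂ →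
      y = c • b₁ + d • b₂ → ∀ {z : K}, intValuation K a ≤ intValuation K z →
      intValuation K b ≤ intValuation K z → z ≠ 0 := by
    rintro a b c d x y hxy hx - z ha hb rfl
    rw [map_zero, le_zero_iff, Valuation.zero_iff] at ha hb
    simp [hx, ha, hb, wedge] at hxy
  -- The position of the largest entry decides which of the two bases is swapped to make it the
  -- pivot.
  rcases le_total (intValuation K α) (intValuation K β) with h12 | h12 <;>
  rcases le_total (intValuation K γ) (intValuation K δ) with h34 | h34
  · rcases le_total (intValuation K β) (intValuation K δ) with h | h
    · rw [Set.pair_comm b₁, Set.pair_comm m₁]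
      exact exists_normalForm_aux hb' (hne hm' h₂ h₁ h34 le_rfl) h34 h (h12.trans h) h₂' h₁' hm'
    · rw [Set.pair_comm b₁]
      exact exists_normalForm_aux hb' (hne hm h₁ h₂ h12 le_rfl) h12 h (h34.trans h) h₁' h₂' hm
  · rcases le_total (intValuation K β) (intValuation K γ) with h | h
    · rw [Set.pair_comm m₁]
      exact exists_normalForm_aux hb (hne hm' h₂ h₁ le_rfl h34) h34 (h12.trans h) h h₂ h₁ hm'
    · rw [Set.pair_comm b₁]
      exact exists_normalForm_aux hb' (hne hm h₁ h₂ h12 le_rfl) h12 (h34.trans h) h h₁' h₂' hm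
  · rcases le_total (intValuation K α) (intValuation K δ) with h | h
    · rw [Set.pair_comm b₁, Set.pair_comm m₁]
      exact exists_normalForm_aux hb' (hne hm' h₂ h₁ h34 le_rfl) h34 (h12.trans h) h h₂' h₁' hm'
    · exact exists_normalForm_aux hb (hne hm h₁ h₂ le_rfl h12) h12 (h34.trans h) h h₁ h₂ hm
  · rcases le_total (intValuation K α) (intValuation K γ) with h | h
    · rw [Set.pair_comm m₁]
      exact exists_normalForm_aux hb (hne hm' h₂ h₁ le_rfl h34) h34 h (h12.trans h) h₂ h₁ hm'
    · exact exists_normalForm_aux hb (hne hm h₁ h₂ le_rfl h12) h12 h (h34.trans h) h₁ h₂ hm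

end Lattices

/-! ### The path metric in terms of determinants -/

section LatticeDistance

open ValuativeRel WithZero

variable {K : Type*} [Field K] [ValuativeRel K]

theorem Vertex.mk_eq_mk {L M : OLattice K} :
    Vertex.mk L = Vertex.mk M ↔ ∃ x : Kˣ, L.1 = x • M.1 := Quotient.eq

theorem smul_span_pair (c : Kˣ) (e f : Fin 2 → K) :
    c • Submodule.span 𝒪[K] {e, f} = Submodule.span 𝒪[K] {(c : K) • e, (c : K) • f} := by
  change Submodule.map _ _ = _
  rw [Submodule.map_span, Set.image_pair]
  rfl

theorem Vertex.mk_surjective : Function.Surjective (Vertex.mk (K := K)) := Quotient.exists_rep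

variable [TopologicalSpace K] [IsNonarchimedeanLocalField K]

/-- The absolute values of the determinants of a vector of `L` and a vector of `M`. -/
def wedgeValues (L M : OLattice K) : Set ℤᵐ⁰ :=
  {r | ∃ x ∈ L.1, ∃ y ∈ M.1, intValuation K (wedge x y) = r}

theorem isGreatest_wedgeValues {L M : OLattice K} {e f : Fin 2 → K} {n : ℕ} {c : K}
    (hL : L.1 = Submodule.span 𝒪[K] {e, f})
    (hM : M.1 = Submodule.span 𝒪[K] {c • e, (c * unif K ^ n) • f}) :
    IsGreatest (wedgeValues L M) (intValuation K (c * wedge e f)) := by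
  constructor
  · refine ⟨f, ?_, c • e, ?_, ?_⟩
    · rw [hL]
      exact Submodule.subset_span (by simp)
    · rw [hM]
      exact Submodule.subset_span (by simp)
    · rw [wedge_smul_right, wedge_comm f e, mul_neg, Valuation.map_neg]
  · rintro _ ⟨x, hx, y, hy, rfl⟩
    rw [hL, mem_span_pair] at hx
    rw [hM, mem_span_pair] at hy
    obtain ⟨a, b, ha, hb, rfl⟩ := hx
    obtain ⟨a', b', ha', hb', rfl⟩ := hy
    have : wedge (a • e + b • f) (a' • c • e + b' • (c * unif K ^ n) • f) =
        (a * b' * unif K ^ n - b * a') * (c * wedge e f) := by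
      simp only [wedge_add_left, wedge_add_right, wedge_smul_left, wedge_smul_right, wedge_self,
        wedge_comm f e]
      ring
    rw [this, map_mul]
    refine mul_le_of_le_one_left' ((Valuation.map_sub _ _ _).trans (max_le ?_ ?_))
    · rw [map_mul, map_mul, map_pow]
      refine mul_le_one' (mul_le_one' ha hb') (pow_le_one' ?_ n)
      rw [intValuation_unif, ← exp_zero, exp_le_exp]
      norm_num
    · rw [map_mul]
      exact mul_le_one' hb ha'

theorem exists_isGreatest_wedgeValues (L M : OLattice K) :
    ∃ r, r ≠ 0 ∧ IsGreatest (wedgeValues L M) r := by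
  obtain ⟨e, f, n, c, h, hc, hL, hM⟩ := L.exists_normalForm M
  exact ⟨_, (intValuation K).ne_zero_iff.mpr (mul_ne_zero hc h), isGreatest_wedgeValues hL hM⟩

/-- The largest absolute value of the determinant of a vector of `L` and a vector of `M`, on a
logarithmic scale. -/
def wedgeLog (L M : OLattice K) : ℤ := log (exists_isGreatest_wedgeValues L M).choose

theorem isGreatest_exp_wedgeLog (L M : OLattice K) :
    IsGreatest (wedgeValues L M) (exp (wedgeLog L M)) := by
  obtain ⟨h0, h⟩ := (exists_isGreatest_wedgeValues L M).choose_spec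
  rwa [wedgeLog, exp_log h0]

theorem wedgeLog_eq {L M : OLattice K} {r : ℤᵐ⁰} (h : IsGreatest (wedgeValues L M) r) :
    wedgeLog L M = log r := by
  rw [h.unique (isGreatest_exp_wedgeLog L M), log_exp]

theorem wedgeLog_comm (L M : OLattice K) : wedgeLog L M = wedgeLog M L := by
  have : wedgeValues L M = wedgeValues M L := by
    ext r
    constructor <;>
    · rintro ⟨x, hx, y, hy, rfl⟩
      exact ⟨y, hy, x, hx, by rw [wedge_comm, Valuation.map_neg]⟩
  have h := isGreatest_exp_wedgeLog L M
  rw [this] at h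
  rw [wedgeLog_eq h, log_exp]

/-- The Plücker relation is applied to vectors attaining both maxima on the left. -/
theorem wedgeLog_four_point (L M P Q : OLattice K) :
    wedgeLog L M + wedgeLog P Q ≤
      max (wedgeLog L P + wedgeLog M Q) (wedgeLog L Q + wedgeLog M P) := by
  obtain ⟨l, hl, m, hm, h1⟩ := (isGreatest_exp_wedgeLog L M).1
  obtain ⟨p, hp, q, hq, h2⟩ := (isGreatest_exp_wedgeLog P Q).1
  rw [← exp_le_exp, exp_add, ← h1, ← h2, ← map_mul, wedge_mul_wedge]
  refine (Valuation.map_sub _ _ _).trans (max_le ?_ ?_)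
  · refine le_trans ?_ (exp_le_exp.mpr (le_max_left _ _))
    rw [map_mul, exp_add]
    exact mul_le_mul' ((isGreatest_exp_wedgeLog L P).2 ⟨l, hl, p, hp, rfl⟩)
      ((isGreatest_exp_wedgeLog M Q).2 ⟨m, hm, q, hq, rfl⟩)
  · refine le_trans ?_ (exp_le_exp.mpr (le_max_right _ _))
    rw [map_mul, exp_add]
    exact mul_le_mul' ((isGreatest_exp_wedgeLog L Q).2 ⟨l, hl, q, hq, rfl⟩)
      ((isGreatest_exp_wedgeLog M P).2 ⟨m, hm, p, hp, rfl⟩)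

theorem wedgeLog_smul (g : SL(2, K)) (L M : OLattice K) :
    wedgeLog (g • L) (g • M) = wedgeLog L M := by
  have : wedgeValues (g • L) (g • M) = wedgeValues L M := by
    ext r
    constructor
    · rintro ⟨_, ⟨x, hx, rfl⟩, _, ⟨y, hy, rfl⟩, rfl⟩
      exact ⟨x, hx, y, hy, congrArg _ (wedge_mulVec g x y).symm⟩
    · rintro ⟨x, hx, y, hy, rfl⟩
      exact ⟨_, ⟨x, hx, rfl⟩, _, ⟨y, hy, rfl⟩, congrArg _ (wedge_mulVec g x y)⟩
  have h := isGreatest_exp_wedgeLog (g • L) (g • M)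
  rw [this] at h
  rw [wedgeLog_eq h, log_exp]

/-- The distance of the classes of two lattices in the Bruhat–Tits tree, in terms of
determinants. -/
def latticeDist (L M : OLattice K) : ℤ := 2 * wedgeLog L M - wedgeLog L L - wedgeLog M M

theorem wedgeLog_self {L : OLattice K} {e f : Fin 2 → K}
    (hL : L.1 = Submodule.span 𝒪[K] {e, f}) :
    wedgeLog L L = log (intValuation K (wedge e f)) := by
  have := wedgeLog_eq (isGreatest_wedgeValues (M := L) (n := 0) (c := 1) hL (by simpa using hL))
  rwa [one_mul] at this

theorem latticeDist_eq {L M : OLattice K} {e f : Fin 2 → K} {n : ℕ} {c : K}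
    (h : wedge e f ≠ 0) (hc : c ≠ 0) (hL : L.1 = Submodule.span 𝒪[K] {e, f})
    (hM : M.1 = Submodule.span 𝒪[K] {c • e, (c * unif K ^ n) • f}) :
    latticeDist L M = n := by
  have hc' := (intValuation K).ne_zero_iff.mpr hc
  have h' := (intValuation K).ne_zero_iff.mpr h
  rw [latticeDist, wedgeLog_eq (isGreatest_wedgeValues hL hM), wedgeLog_self hL, wedgeLog_self hM,
    wedge_smul_left, wedge_smul_right, map_mul, map_mul, map_mul, map_mul, intValuation_unif_pow,
    log_mul hc' h', log_mul hc' (mul_ne_zero (mul_ne_zero hc' exp_ne_zero) h'),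
    log_mul (mul_ne_zero hc' exp_ne_zero) h', log_mul hc' exp_ne_zero, log_exp]
  ring

theorem latticeDist_self (L : OLattice K) : latticeDist L L = 0 := by
  rw [latticeDist]
  ring

theorem latticeDist_comm (L M : OLattice K) : latticeDist L M = latticeDist M L := by
  rw [latticeDist, latticeDist, wedgeLog_comm L M]
  ring

theorem latticeDist_four_point (L M P Q : OLattice K) :
    latticeDist L M + latticeDist P Q ≤
      max (latticeDist L P + latticeDist M Q) (latticeDist L Q + latticeDist M P) := by
  have := wedgeLog_four_point L M P Q
  unfold latticeDist
  omega

theorem latticeDist_triangle (L M P : OLattice K) :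
    latticeDist L P ≤ latticeDist L M + latticeDist M P := by
  have := latticeDist_four_point L P M M
  have h1 := latticeDist_self M
  have h2 := latticeDist_comm M P
  omega

theorem mk_eq_mk_iff_latticeDist {L M : OLattice K} :
    Vertex.mk L = Vertex.mk M ↔ latticeDist L M = 0 := by
  constructor
  · intro h
    obtain ⟨x, hx⟩ := Vertex.mk_eq_mk.mp h.symm
    obtain ⟨e, f, h, hL⟩ := L.exists_eq_span
    rw [hL, smul_span_pair] at hx
    simpa using latticeDist_eq (n := 0) h x.ne_zero hL (by simpa using hx)
  · intro h
    obtain ⟨e, f, n, c, hef, hc, hL, hM⟩ := L.exists_normalForm M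
    rw [latticeDist_eq hef hc hL hM] at h
    obtain rfl : n = 0 := by exact_mod_cast h
    symm
    refine Vertex.mk_eq_mk.mpr ⟨Units.mk0 c hc, ?_⟩
    rw [hL, hM, smul_span_pair]
    simp

theorem latticeDist_congr {L L' M M' : OLattice K} (hL : Vertex.mk L = Vertex.mk L')
    (hM : Vertex.mk M = Vertex.mk M') : latticeDist L M = latticeDist L' M' := by
  have h1 := mk_eq_mk_iff_latticeDist.mp hL
  have h2 := mk_eq_mk_iff_latticeDist.mp hM
  have h3 := latticeDist_comm L L'
  have h4 := latticeDist_comm M M'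
  have h5 := latticeDist_triangle L L' M
  have h6 := latticeDist_triangle L' M' M
  have h7 := latticeDist_triangle L' L M'
  have h8 := latticeDist_triangle L M M'
  omega

theorem mem_maximalIdeal_iff {a : 𝒪[K]} :
    a ∈ 𝓂[K] ↔ intValuation K a ≤ intValuation K (unif K) := by
  have h1 : a ∈ 𝓂[K] ↔ intValuation K (a : K) < 1 := by
    rw [IsLocalRing.mem_maximalIdeal, mem_nonunits_iff,
      Valuation.Integer.not_isUnit_iff_valuation_lt_one,
      ← not_le, ← not_le, ← map_one (intValuation K), intValuation_le_iff, map_one]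
  rw [h1, intValuation_unif]
  by_cases h0 : intValuation K (a : K) = 0
  · simp [h0]
  · rw [← exp_log h0, ← exp_zero, exp_lt_exp, exp_le_exp]
    omega

/-- The quotient is killed by ϖ, so ϖf lies in the smaller lattice, whence |ϖ| ≤ |cϖⁿ| ≤ |ϖ|ⁿ and n
≤ 1. -/
theorem latticeDist_le_one_of_isNeighbour {L M : OLattice K}
    (h : IsNeighbour (Vertex.mk L) (Vertex.mk M)) : latticeDist L M ≤ 1 := by
  obtain ⟨P, Q, hP, hQ, hle, ⟨ι⟩⟩ := h
  rw [← latticeDist_congr hP hQ]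
  obtain ⟨e, f, n, c, hef, hc, hL, hM⟩ := P.exists_normalForm Q
  rw [latticeDist_eq hef hc hL hM]
  have hw := (intValuation K).ne_zero_iff.mpr hef
  have hc1 : intValuation K c ≤ 1 := by
    have h1 : c • e ∈ P.1 := hle (by rw [hM]; exact Submodule.subset_span (by simp))
    rw [hL, mem_span_pair_iff_wedge hef, wedge_smul_left, map_mul] at h1
    exact (mul_le_iff_le_one_left (zero_lt_iff.mpr hw)).mp h1.1
  have hf : unif K • f ∈ Q.1 := by
    have hfP : f ∈ P.1 := by
      rw [hL]
      exact Submodule.subset_span (by simp)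
    have hu : unif K ∈ 𝒪[K] := by
      rw [mem_integer_iff, intValuation_unif, ← exp_zero, exp_le_exp]
      norm_num
    have hum : (⟨unif K, hu⟩ : 𝒪[K]) ∈ 𝓂[K] := mem_maximalIdeal_iff.mpr le_rfl
    have hz : (⟨unif K, hu⟩ : 𝒪[K]) •
        Submodule.Quotient.mk (p := Q.1.submoduleOf P.1) ⟨f, hfP⟩ = 0 := by
      apply ι.injective
      rw [map_smul, map_zero]
      obtain ⟨b, hb⟩ := Submodule.Quotient.mk_surjective _ (ι (Submodule.Quotient.mk ⟨f, hfP⟩))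
      rw [← hb, ← Submodule.Quotient.mk_smul, Submodule.Quotient.mk_eq_zero]
      exact Ideal.mul_mem_right _ _ hum
    rw [← Submodule.Quotient.mk_smul, Submodule.Quotient.mk_eq_zero] at hz
    exact hz
  have hw2 : wedge (c • e) ((c * unif K ^ n) • f) ≠ 0 := by
    rw [wedge_smul_left, wedge_smul_right]
    exact mul_ne_zero hc (mul_ne_zero (mul_ne_zero hc (pow_ne_zero _ unif_ne_zero)) hef)
  rw [hM, mem_span_pair_iff_wedge hw2] at hf
  have h2 := hf.2
  have hc' := (intValuation K).ne_zero_iff.mpr hc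
  rw [wedge_smul_left, wedge_smul_left, wedge_smul_right, wedge_smul_right, map_mul, map_mul,
    map_mul, map_mul, map_mul, intValuation_unif_pow, intValuation_unif,
    mul_le_mul_iff_right₀ (zero_lt_iff.mpr hc'), mul_le_mul_iff_left₀ (zero_lt_iff.mpr hw)] at h2
  have h3 := h2.trans (mul_le_mul_left hc1 _)
  rw [one_mul, exp_le_exp] at h3
  omega

theorem isNeighbour_of_eq_span {L M : OLattice K} {e f : Fin 2 → K} (h : wedge e f ≠ 0)
    (hL : L.1 = Submodule.span 𝒪[K] {e, f}) (hM : M.1 = Submodule.span 𝒪[K] {e, unif K • f}) :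
    IsNeighbour (Vertex.mk L) (Vertex.mk M) := by
  have hw := (intValuation K).ne_zero_iff.mpr h
  have hu1 : intValuation K (unif K) ≤ 1 := by
    rw [intValuation_unif, ← exp_zero, exp_le_exp]
    norm_num
  have hfL : f ∈ L.1 := by
    rw [hL]
    exact Submodule.subset_span (by simp)
  have hw2 : wedge e (unif K • f) ≠ 0 := by
    rw [wedge_smul_right]
    exact mul_ne_zero unif_ne_zero h
  refine ⟨L, M, rfl, rfl, ?_, ⟨?_⟩⟩
  · rw [hL, hM, span_pair_le_iff]
    refine ⟨Submodule.subset_span (by simp), mem_span_pair.mpr ⟨0, unif K, by simp, hu1, ?_⟩⟩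
    module
  · let φ : 𝒪[K] →ₗ[𝒪[K]] (L.1 ⧸ M.1.submoduleOf L.1) :=
      LinearMap.toSpanSingleton _ _ (Submodule.Quotient.mk ⟨f, hfL⟩)
    have hφ : Function.Surjective φ := by
      intro y
      obtain ⟨⟨x, hx⟩, rfl⟩ := Submodule.Quotient.mk_surjective _ y
      have hx' := hx
      rw [hL, mem_span_pair] at hx'
      obtain ⟨a, b, ha, hb, rfl⟩ := hx'
      refine ⟨⟨b, mem_integer_iff.mpr hb⟩, ?_⟩
      rw [LinearMap.toSpanSingleton_apply, ← Submodule.Quotient.mk_smul, Submodule.Quotient.eq]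
      change b • f - (a • e + b • f) ∈ M.1
      rw [hM, mem_span_pair]
      exact ⟨-a, 0, by rwa [Valuation.map_neg], by simp, by module⟩
    have hker : LinearMap.ker φ = 𝓂[K] := by
      ext b
      rw [LinearMap.mem_ker, LinearMap.toSpanSingleton_apply, ← Submodule.Quotient.mk_smul,
        Submodule.Quotient.mk_eq_zero, mem_maximalIdeal_iff]
      change (b : K) • f ∈ M.1 ↔ _
      rw [hM, mem_span_pair_iff_wedge hw2]
      simp only [wedge_smul_left, wedge_smul_right, wedge_self, map_mul, mul_zero, map_zero, zero_le,
        true_and]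
      exact mul_le_mul_iff_left₀ (zero_lt_iff.mpr hw)
    exact ((Submodule.quotEquivOfEq _ _ hker.symm).trans
      (φ.quotKerEquivOfSurjective hφ)).symm

/-- In the normal form, the lattice with basis e, ϖᵏf interpolates. The clause for k = 1 supplies
the edges of walks. -/
theorem exists_lattice_between (L M : OLattice K) {k : ℤ} (h0 : 0 ≤ k) (hk : k ≤ latticeDist L M) :
    ∃ P : OLattice K, latticeDist L P = k ∧ latticeDist P M = latticeDist L M - k ∧
      (k = 1 → IsNeighbour (Vertex.mk L) (Vertex.mk P)) := by
  obtain ⟨e, f, n, c, hef, hc, hL, hM⟩ := L.exists_normalForm M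
  have hn := latticeDist_eq hef hc hL hM
  rw [hn] at hk ⊢
  lift k to ℕ using h0
  have hkn : k ≤ n := by exact_mod_cast hk
  have hP : wedge e (unif K ^ k • f) ≠ 0 := by
    rw [wedge_smul_right]
    exact mul_ne_zero (pow_ne_zero _ unif_ne_zero) hef
  refine ⟨OLattice.ofPair hP, ?_, ?_, ?_⟩
  · exact latticeDist_eq hef one_ne_zero hL (by simp [OLattice.ofPair])
  · rw [← Nat.cast_sub hkn]
    refine latticeDist_eq hP hc rfl ?_
    rw [hM, smul_smul, mul_assoc, ← pow_add, Nat.sub_add_cancel hkn]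
  · intro h1
    obtain rfl : k = 1 := by exact_mod_cast h1
    exact isNeighbour_of_eq_span hef hL (by simp [OLattice.ofPair])

theorem exists_walk (n : ℕ) (L M : OLattice K) (h : latticeDist L M = n) :
    ∃ w : (tree K).Walk (Vertex.mk L) (Vertex.mk M), w.length = n := by
  induction n generalizing L with
  | zero =>
    have := mk_eq_mk_iff_latticeDist.mpr h
    exact this ▸ ⟨.nil, rfl⟩
  | succ n ih =>
    obtain ⟨P, hLP, hPM, hN⟩ := exists_lattice_between L M (k := 1) (by omega) (by omega)
    obtain ⟨w, hw⟩ := ih P (by omega)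
    have hadj : (tree K).Adj (Vertex.mk L) (Vertex.mk P) := by
      rw [tree, SimpleGraph.fromRel_adj]
      refine ⟨fun he => ?_, .inl (hN rfl)⟩
      rw [mk_eq_mk_iff_latticeDist] at he
      omega
    exact ⟨.cons hadj w, by simp [hw]⟩

theorem latticeDist_nonneg (L M : OLattice K) : 0 ≤ latticeDist L M := by
  obtain ⟨e, f, n, c, hef, hc, hL, hM⟩ := L.exists_normalForm M
  rw [latticeDist_eq hef hc hL hM]
  positivity

theorem latticeDist_le_length {x y : Vertex K} (w : (tree K).Walk x y) {L M : OLattice K}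
    (hL : Vertex.mk L = x) (hM : Vertex.mk M = y) : latticeDist L M ≤ w.length := by
  induction w generalizing L with
  | nil =>
    rw [mk_eq_mk_iff_latticeDist.mp (hL.trans hM.symm)]
    simp
  | @cons _ z _ hadj w ih =>
    obtain ⟨P, rfl⟩ := Vertex.mk_surjective z
    have h1 := ih (L := P) rfl hM
    have h2 : latticeDist L P ≤ 1 := by
      subst hL
      rw [tree, SimpleGraph.fromRel_adj] at hadj
      rcases hadj.2 with h | h
      · exact latticeDist_le_one_of_isNeighbour h
      · rw [latticeDist_comm]
        exact latticeDist_le_one_of_isNeighbour h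
    have h3 := latticeDist_triangle L P M
    rw [SimpleGraph.Walk.length_cons]
    push_cast
    omega

theorem dist_mk (L M : OLattice K) :
    ((tree K).dist (Vertex.mk L) (Vertex.mk M) : ℤ) = latticeDist L M := by
  have h0 := latticeDist_nonneg L M
  obtain ⟨w, hw⟩ := exists_walk (latticeDist L M).toNat L M (by omega)
  obtain ⟨w', hw'⟩ := w.reachable.exists_walk_length_eq_dist
  have h1 := SimpleGraph.dist_le w
  have h2 := latticeDist_le_length w' rfl rfl
  omega

-- Both parities are read off from the formula: in a perimeter every w occurs twice, and w(gL,gL) =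
-- w(L,L) because det g = 1.
variable (K) in
theorem isTreeAction :
    IsTreeAction SL(2, K) (fun x y : Vertex K => ((tree K).dist x y : ℤ)) where
  dist_self x := by simp
  eq_of_dist := by
    rintro ⟨L⟩ ⟨M⟩ h
    exact mk_eq_mk_iff_latticeDist.mpr ((dist_mk L M).symm.trans h)
  symm x y := by rw [SimpleGraph.dist_comm]
  smul g := by
    rintro ⟨L⟩ ⟨M⟩
    refine (dist_mk _ _).trans (Eq.trans ?_ (dist_mk L M).symm)
    simp only [latticeDist, wedgeLog_smul]
  four_point := by
    rintro ⟨L⟩ ⟨M⟩ ⟨P⟩ ⟨Q⟩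
    have := latticeDist_four_point L M P Q
    simp only [← dist_mk] at this
    exact this
  exists_between := by
    rintro ⟨L⟩ ⟨M⟩ k h0 hk
    obtain ⟨P, h1, h2, -⟩ := exists_lattice_between L M h0 (hk.trans (dist_mk L M).le)
    exact ⟨Vertex.mk P, (dist_mk _ _).trans h1,
      (dist_mk _ _).trans (h2.trans (congrArg (· - k) (dist_mk L M).symm))⟩
  even_perimeter := by
    rintro ⟨L⟩ ⟨M⟩ ⟨P⟩
    have : Even (latticeDist L M + latticeDist M P + latticeDist L P) := by
      unfold latticeDist
      exact ⟨wedgeLog L M + wedgeLog M P + wedgeLog L P - wedgeLog L L - wedgeLog M M -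
        wedgeLog P P, by ring⟩
    simp only [← dist_mk] at this
    exact this
  even_displacement := by
    rintro g ⟨L⟩
    have : Even (latticeDist L (g • L)) := by
      unfold latticeDist
      rw [wedgeLog_smul]
      exact ⟨wedgeLog L (g • L) - wedgeLog L L, by ring⟩
    rw [← dist_mk] at this
    exact this

instance : Nonempty (Vertex K) :=
  ⟨Vertex.mk (OLattice.ofPair (e := Pi.single 0 1) (f := Pi.single 1 1) (by simp [wedge]))⟩

end LatticeDistance

/-! ### Vertex stabilizers are open and compact -/

section Topology

open ValuativeRel WithZero

variable {K : Type*} [Field K] [ValuativeRel K]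

theorem act_apply_apply (g : SL(2, K)) (x : Fin 2 → K) (i : Fin 2) :
    act g x i = g i 0 * x 0 + g i 1 * x 1 := by
  rw [act_apply, Matrix.mulVec, dotProduct, Fin.sum_univ_two]

theorem smul_val_le_iff {g : SL(2, K)} {L : OLattice K} {e f : Fin 2 → K}
    (hL : L.1 = Submodule.span 𝒪[K] {e, f}) :
    (g • L).1 ≤ L.1 ↔ act g e ∈ L.1 ∧ act g f ∈ L.1 := by
  rw [smul_val, Submodule.map_le_iff_le_comap]
  nth_rw 1 [hL]
  rw [span_pair_le_iff]
  rfl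

theorem smul_eq_of_le {g : SL(2, K)} {L : OLattice K} (h : (g • L).1 ≤ L.1)
    (h' : (g⁻¹ • L).1 ≤ L.1) : g • L = L := by
  refine Subtype.ext (le_antisymm h ?_)
  have := Submodule.map_mono (f := (act g).toLinearMap) h'
  rwa [← smul_val, ← smul_val, smul_inv_smul] at this

variable [TopologicalSpace K] [IsNonarchimedeanLocalField K]

theorem isOpen_intValuation_le {z : K} (hz : z ≠ 0) :
    IsOpen {y : K | intValuation K y ≤ intValuation K z} := by
  have h : IsOpen (𝒪[K] : Set K) := Valuation.isOpen_integer
  convert! h.preimage (continuous_id.div_const z) using 1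
  ext y
  have hz' := zero_lt_iff.mpr ((intValuation K).ne_zero_iff.mpr hz)
  simp only [Set.mem_ofPred_eq, Set.mem_preimage, id, SetLike.mem_coe, mem_integer_iff, map_div₀]
  rw [div_le_one₀ hz']

theorem continuous_wedge : Continuous fun q : (Fin 2 → K) × (Fin 2 → K) => wedge q.1 q.2 := by
  unfold wedge
  fun_prop

theorem isOpen_span_pair {e f : Fin 2 → K} (h : wedge e f ≠ 0) :
    IsOpen (Submodule.span 𝒪[K] {e, f} : Set (Fin 2 → K)) := by
  have h1 : IsOpen {x : Fin 2 → K | intValuation K (wedge x f) ≤ intValuation K (wedge e f)} :=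
    (isOpen_intValuation_le h).preimage
      (continuous_wedge.comp (Continuous.prodMk continuous_id continuous_const))
  have h2 : IsOpen {x : Fin 2 → K | intValuation K (wedge e x) ≤ intValuation K (wedge e f)} :=
    (isOpen_intValuation_le h).preimage
      (continuous_wedge.comp (Continuous.prodMk continuous_const continuous_id))
  convert! h1.inter h2 using 1
  ext x
  exact mem_span_pair_iff_wedge h

theorem isCompact_span_pair (e f : Fin 2 → K) :
    IsCompact (Submodule.span 𝒪[K] {e, f} : Set (Fin 2 → K)) := by
  have hc : IsCompact {x : K | valuation K x ≤ 1} :=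
    IsNonarchimedeanLocalField.isCompact_closedBall K 1
  have := (hc.prod hc).image
    (f := fun q : K × K => q.1 • e + q.2 • f) (by fun_prop)
  convert! this using 1
  ext x
  simp only [SetLike.mem_coe, mem_span_pair, ← mem_integer_iff, Set.mem_image, Set.mem_prod,
    Prod.exists, Set.mem_ofPred_eq, Valuation.mem_integer_iff, and_assoc]

theorem continuous_act (x : Fin 2 → K) : Continuous fun g : SL(2, K) => act g x :=
  (continuous_subtype_val.matrix_mulVec continuous_const :
    Continuous fun g : SL(2, K) => Matrix.mulVec (g : Matrix (Fin 2) (Fin 2) K) x)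

/-- Lattices are open, and g fixes L as soon as g and g⁻¹ map a basis of L into L. -/
theorem isOpen_stabilizer (x : Vertex K) :
    IsOpen (MulAction.stabilizer SL(2, K) x : Set SL(2, K)) := by
  obtain ⟨L, rfl⟩ := Vertex.mk_surjective x
  obtain ⟨e, f, hef, hL⟩ := L.exists_eq_span
  have ho : IsOpen (L.1 : Set (Fin 2 → K)) := by
    rw [hL]
    exact isOpen_span_pair hef
  have he : e ∈ L.1 := by rw [hL]; exact Submodule.subset_span (by simp)
  have hf : f ∈ L.1 := by rw [hL]; exact Submodule.subset_span (by simp)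
  refine Subgroup.isOpen_of_mem_nhds (g := 1) _ (Filter.mem_of_superset
    ((((ho.preimage (continuous_act e)).inter (ho.preimage (continuous_act f))).inter
      ((ho.preimage ((continuous_act e).comp continuous_inv)).inter
        (ho.preimage ((continuous_act f).comp continuous_inv)))).mem_nhds ?_) ?_)
  · have h1 : ∀ x : Fin 2 → K, act (1 : SL(2, K)) x = x := fun x => by
      rw [act_apply, Matrix.SpecialLinearGroup.coe_one, Matrix.one_mulVec]
    simp only [Set.mem_inter_iff, Set.mem_preimage, Function.comp_apply, inv_one, h1,
      SetLike.mem_coe]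
    exact ⟨⟨he, hf⟩, he, hf⟩
  · rintro g ⟨⟨h1, h2⟩, h3, h4⟩
    exact congrArg Vertex.mk (smul_eq_of_le ((smul_val_le_iff hL).mpr ⟨h1, h2⟩)
      ((smul_val_le_iff hL).mpr ⟨h3, h4⟩))

/-- If gL = cL, comparing determinants gives |c|² = 1, so c is a unit and L itself is preserved. -/
theorem smul_le_of_smul_mk_eq {g : SL(2, K)} {L : OLattice K}
    (h : g • Vertex.mk L = Vertex.mk L) : (g • L).1 ≤ L.1 := by
  obtain ⟨c, hc⟩ := Vertex.mk_eq_mk.mp h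
  obtain ⟨e, f, hef, hL⟩ := L.exists_eq_span
  have hc' : intValuation K (c : K) ≠ 0 := (intValuation K).ne_zero_iff.mpr c.ne_zero
  have hw := (intValuation K).ne_zero_iff.mpr hef
  rw [hL, smul_span_pair] at hc
  have h1 := wedgeLog_self hc
  rw [wedgeLog_smul, wedgeLog_self hL, wedge_smul_left, wedge_smul_right, map_mul, map_mul,
    log_mul hc' (mul_ne_zero hc' hw), log_mul hc' hw] at h1
  have h2 : intValuation K (c : K) = 1 := by
    rw [← exp_log hc', ← exp_zero]
    congr 1
    omega
  rw [hc, hL, span_pair_le_iff, mem_span_pair, mem_span_pair]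
  exact ⟨⟨c, 0, h2.le, by simp, by module⟩, ⟨0, c, by simp, h2.le, by module⟩⟩

-- The value group is countable, so 0 has a countable basis of neighbourhoods.
variable (K) in
theorem metrizableSpace : TopologicalSpace.MetrizableSpace K := by
  have hb := IsValuativeTopology.hasBasis_nhds_zero' K
  have : Countable ℤᵐ⁰ := inferInstanceAs (Countable (Option ℤ))
  have : Countable (ValueGroupWithZero K) :=
    (IsNonarchimedeanLocalField.valueGroupWithZeroIsoInt K).toEquiv.countable_iff.mpr inferInstance
  have hc : (nhds (0 : K)).IsCountablyGenerated :=
    Filter.HasCountableBasis.isCountablyGenerated ⟨hb, Set.to_countable _⟩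
  let := IsTopologicalAddGroup.rightUniformSpace K
  have := isUniformAddGroup_of_addCommGroup (G := K)
  have := IsUniformAddGroup.uniformity_countably_generated (α := K)
  exact UniformSpace.metrizableSpace

/-- An element of the stabilizer is recovered continuously from the images of a basis of L, which
range over the compact set L × L. -/
theorem isCompact_stabilizer (x : Vertex K) :
    IsCompact (MulAction.stabilizer SL(2, K) x : Set SL(2, K)) := by
  obtain ⟨L, rfl⟩ := Vertex.mk_surjective x
  obtain ⟨e, f, hef, hL⟩ := L.exists_eq_span
  have hc : IsCompact (L.1 : Set (Fin 2 → K)) := by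
    rw [hL]
    exact isCompact_span_pair e f
  let P : Matrix (Fin 2) (Fin 2) K := (Matrix.of ![e, f]).transpose
  have hP : IsUnit P.det := by
    rw [isUnit_iff_ne_zero]
    convert! hef using 1
    simp [P, Matrix.det_fin_two, wedge]
  let F : (Fin 2 → K) × (Fin 2 → K) → Matrix (Fin 2) (Fin 2) K :=
    fun q => (Matrix.of ![q.1, q.2]).transpose * P⁻¹
  have hF : Continuous F := by
    refine Continuous.matrix_mul (Continuous.matrix_transpose ?_) continuous_const
    refine continuous_matrix fun i j => ?_
    fin_cases i
    · exact (continuous_apply j).comp continuous_fst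
    · exact (continuous_apply j).comp continuous_snd
  have := metrizableSpace K
  refine (Matrix.SpecialLinearGroup.isClosedEmbedding_val.isCompact_preimage
    ((hc.prod hc).image hF)).of_isClosed_subset
    ((MulAction.stabilizer SL(2, K) (Vertex.mk L)).isClosed_of_isOpen (isOpen_stabilizer _)) ?_
  intro (g : SL(2, K)) hg
  obtain ⟨h1, h2⟩ := (smul_val_le_iff hL).mp (smul_le_of_smul_mk_eq hg)
  refine ⟨(act g e, act g f), ⟨h1, h2⟩, ?_⟩
  have : (Matrix.of ![act g e, act g f]).transpose = (g : Matrix (Fin 2) (Fin 2) K) * P := by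
    ext i j
    fin_cases j <;> simp [P, act_apply_apply, Matrix.mul_apply]
  simp only [F]
  rw [this, Matrix.mul_assoc, Matrix.mul_nonsing_inv _ hP, mul_one]

variable (K) in
theorem metrizableSpace_SL : TopologicalSpace.MetrizableSpace SL(2, K) := by
  have := metrizableSpace K
  have : TopologicalSpace.MetrizableSpace (Matrix (Fin 2) (Fin 2) K) :=
    inferInstanceAs (TopologicalSpace.MetrizableSpace (Fin 2 → Fin 2 → K))
  exact (Topology.IsEmbedding.subtypeVal :
    Topology.IsEmbedding ((↑) : SL(2, K) → Matrix (Fin 2) (Fin 2) K)).metrizableSpace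

/-- A discrete torsion-free group contains no nontrivial element fixing a vertex. -/
theorem eq_one_of_smul_eq {H : Subgroup SL(2, K)} [DiscreteTopology H] [IsMulTorsionFree H]
    {g : SL(2, K)} (hg : g ∈ H) {x : Vertex K} (hx : g • x = x) : g = 1 := by
  have := metrizableSpace_SL K
  have hcl : IsClosed (H : Set SL(2, K)) := Subgroup.isClosed_of_discrete
  -- A discrete subgroup is closed, so it meets the compact stabilizer in a finite set; this set
  -- contains all powers of g.
  have hfin : ((H : Set SL(2, K)) ∩ MulAction.stabilizer SL(2, K) x).Finite := by
    refine ((isCompact_stabilizer x).inter_left hcl).finite ?_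
    exact IsDiscrete.mono ⟨inferInstance⟩ Set.inter_subset_left
  have hsub : (Subgroup.zpowers g : Set SL(2, K)) ⊆
      (H : Set SL(2, K)) ∩ MulAction.stabilizer SL(2, K) x := by
    have : Subgroup.zpowers g ≤ H ⊓ MulAction.stabilizer SL(2, K) x := by
      rw [Subgroup.zpowers_le]
      exact ⟨hg, hx⟩
    exact this
  have hfo : IsOfFinOrder g := by
    rw [← finite_zpowers]
    exact hfin.subset hsub
  have h1 : IsOfFinOrder (⟨g, hg⟩ : H) :=
    (H.subtype_injective.isOfFinOrder_iff (f := H.subtype)).mp hfo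
  exact congrArg Subtype.val (isOfFinOrder_iff_eq_one _ |>.mp h1)

end Topology

end BruhatTits

/-! ### Free groups of rank two are not cyclic -/

section FreeRankTwo

variable {G : Type*} [Group G]

theorem FreeGroup.of_mul_of_ne : (FreeGroup.of 0 * FreeGroup.of 1 : FreeGroup (Fin 2)) ≠
    FreeGroup.of 1 * FreeGroup.of 0 := by
  intro h
  have := congrArg FreeGroup.toWord h
  revert this
  decide

theorem not_le_zpowers_of_mulEquiv_freeGroup {H : Subgroup G} (e : H ≃* FreeGroup (Fin 2))
    (z : G) : ¬ H ≤ Subgroup.zpowers z := by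
  intro hle
  have hcomm : ∀ a b : H, a * b = b * a := by
    rintro ⟨a, ha⟩ ⟨b, hb⟩
    obtain ⟨m, rfl⟩ := hle ha
    obtain ⟨n, rfl⟩ := hle hb
    exact Subtype.ext (Commute.zpow_zpow_self z m n)
  apply FreeGroup.of_mul_of_ne
  apply e.symm.injective
  rw [map_mul, map_mul, hcomm]

/-- If one of the four elements were trivial, X and Y would both be powers of X or both powers of Y.
-/
theorem ne_one_of_closure_mulEquiv_freeGroup {X Y : G}
    (e : Subgroup.closure {X, Y} ≃* FreeGroup (Fin 2)) :
    X ≠ 1 ∧ Y ≠ 1 ∧ X * Y ≠ 1 ∧ X⁻¹ * Y ≠ 1 := by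
  have key : ∀ z, X ∈ Subgroup.zpowers z → Y ∈ Subgroup.zpowers z → False := by
    intro z hX hY
    refine not_le_zpowers_of_mulEquiv_freeGroup e z ((Subgroup.closure_le _).mpr ?_)
    rintro _ (rfl | rfl)
    exacts [hX, hY]
  refine ⟨?_, ?_, ?_, ?_⟩
  · rintro rfl
    exact key Y (one_mem _) (Subgroup.mem_zpowers _)
  · rintro rfl
    exact key X (Subgroup.mem_zpowers _) (one_mem _)
  · intro h
    rw [mul_eq_one_iff_inv_eq] at h
    exact key X (Subgroup.mem_zpowers _) (h ▸ inv_mem (Subgroup.mem_zpowers _))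
  · intro h
    rw [inv_mul_eq_one] at h
    exact key X (Subgroup.mem_zpowers _) (h ▸ Subgroup.mem_zpowers _)

end FreeRankTwo

namespace BruhatTits

/-! ### Correctness of the two answers -/

section Correctness

variable {K : Type*} [Field K] [ValuativeRel K]

theorem translationLength_le (g : SL(2, K)) (x : Vertex K) :
    translationLength g ≤ (tree K).dist x (g • x) := ciInf_le (OrderBot.bddBelow _) x

theorem exists_dist_eq_translationLength (g : SL(2, K)) :
    ∃ x : Vertex K, (tree K).dist x (g • x) = translationLength g :=
  Nat.sInf_mem (Set.range_nonempty _)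

variable [TopologicalSpace K] [IsNonarchimedeanLocalField K]

theorem eq_one_of_translationLength_eq_zero {H : Subgroup SL(2, K)}
    (hH : IsDiscreteFreeRankTwo H) {g : SL(2, K)} (hg : g ∈ H) (h : translationLength g = 0) :
    g = 1 := by
  obtain ⟨x, hx⟩ := exists_dist_eq_translationLength g
  obtain ⟨hd, ⟨e⟩⟩ := hH
  have : IsMulTorsionFree H := e.injective.isMulTorsionFree e.toMonoidHom
  refine eq_one_of_smul_eq hg (x := x) ((isTreeAction K).eq_of_dist _ _ ?_).symm
  exact_mod_cast hx.trans h

theorem not_isDiscreteFreeRankTwo_of_translationLength_eq_zero {X Y : SL(2, K)}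
    (h : translationLength X = 0 ∨ translationLength Y = 0 ∨ translationLength (X * Y) = 0 ∨
      translationLength (X⁻¹ * Y) = 0) :
    ¬ IsDiscreteFreeRankTwo (Subgroup.closure {X, Y}) := by
  intro hH
  obtain ⟨e⟩ := hH.2
  obtain ⟨h1, h2, h3, h4⟩ := ne_one_of_closure_mulEquiv_freeGroup e
  have hX : X ∈ Subgroup.closure {X, Y} := Subgroup.subset_closure (by simp)
  have hY : Y ∈ Subgroup.closure {X, Y} := Subgroup.subset_closure (by simp)
  rcases h with h | h | h | h
  · exact h1 (eq_one_of_translationLength_eq_zero hH hX h)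
  · exact h2 (eq_one_of_translationLength_eq_zero hH hY h)
  · exact h3 (eq_one_of_translationLength_eq_zero hH (mul_mem hX hY) h)
  · exact h4 (eq_one_of_translationLength_eq_zero hH (mul_mem (inv_mem hX) hY) h)

theorem isDiscreteFreeRankTwo_and_pingPong_of_sets {X Y : SL(2, K)} {p : Vertex K}
    {S : Fin 2 × Bool → Set (Vertex K)} (hp : ∀ i, p ∉ S i) (hne : ∀ i, (S i).Nonempty)
    (hS : ∀ i j, i ≠ j → ∀ u ∈ S i, ∀ v ∈ S j, 1 < (tree K).dist u v)
    (ha : ∀ i x, x ∉ S (i, false) → ![X, Y] i • x ∈ S (i, true))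
    (ha' : ∀ i x, x ∉ S (i, true) → (![X, Y] i)⁻¹ • x ∈ S (i, false)) :
    IsDiscreteFreeRankTwo (Subgroup.closure {X, Y}) ∧ PingPong (Realization (tree K)) X Y := by
  have hsep : ∀ i j, i ≠ j → ∀ u ∈ S i, ∀ v ∈ S j, u ≠ v ∧ ¬ (tree K).Adj u v := by
    intro i j hij u hu v hv
    have := hS i j hij u hu v hv
    refine ⟨?_, fun hadj => ?_⟩
    · rintro rfl
      simp at this
    · rw [SimpleGraph.dist_eq_one_iff_adj.mpr hadj] at this
      omega
  have hdisj : Pairwise (Function.onFun Disjoint S) := fun i j hij =>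
    Set.disjoint_left.mpr fun u hu hv => (hsep i j hij u hu u hv).1 rfl
  have hw : ∀ w : FreeGroup (Fin 2), FreeGroup.lift ![X, Y] w • p = p → w = 1 := fun w h =>
    FreeGroup.eq_one_of_pingPong_of_lift_smul_eq hdisj hp ha ha' h
  have hgen : ∀ i, (![X, Y] i) ≠ 1 := by
    intro i h
    exact FreeGroup.of_ne_one i (hw (FreeGroup.of i) (by rw [FreeGroup.lift_apply_of, h, one_smul]))
  refine ⟨isDiscreteFreeRankTwo_of_forall_lift_smul_eq (isOpen_stabilizer p) hw,
    inferInstance, metrizableSpace_SL K, Realization.continuousSMul isOpen_stabilizer,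
    hgen 0, hgen 1, ?_⟩
  have hull_ne : ∀ i, (Realization.hull (tree K) (S i)).Nonempty := fun i =>
    (hne i).elim fun x hx => ⟨_, Realization.ofVertex_mem_hull.mpr hx⟩
  have hull_disj : ∀ i j, i ≠ j →
      Disjoint (Realization.hull (tree K) (S i)) (Realization.hull (tree K) (S j)) :=
    fun i j hij => Realization.disjoint_hull (hsep i j hij)
  refine ⟨Realization.hull (tree K) (S (0, true)), Realization.hull (tree K) (S (0, false)),
    Realization.hull (tree K) (S (1, true)), Realization.hull (tree K) (S (1, false)),
    ⟨hull_ne _, hull_ne _, hull_ne _, hull_ne _⟩,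
    ⟨Realization.isClosed_hull _, Realization.isClosed_hull _, Realization.isClosed_hull _,
      Realization.isClosed_hull _⟩, ?_, ?_,
    Realization.smul_hull_compl_subset (ha 0), Realization.smul_hull_compl_subset (ha' 0),
    Realization.smul_hull_compl_subset (ha 1), Realization.smul_hull_compl_subset (ha' 1)⟩
  · simp only [List.pairwise_cons, List.mem_cons, List.not_mem_nil, or_false, forall_eq_or_imp,
      forall_eq]
    refine ⟨⟨?_, ?_, ?_⟩, ⟨?_, ?_⟩, ?_, ?_⟩
    · exact hull_disj _ _ (by decide)
    · exact hull_disj _ _ (by decide)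
    · exact hull_disj _ _ (by decide)
    · exact hull_disj _ _ (by decide)
    · exact hull_disj _ _ (by decide)
    · exact hull_disj _ _ (by decide)
    · simp
  · intro huniv
    have hmem : Realization.ofVertex (tree K) p ∈ (Set.univ : Set (Realization (tree K))) :=
      Set.mem_univ _
    rw [← huniv] at hmem
    simp only [Set.mem_union, Realization.ofVertex_mem_hull] at hmem
    simp [hp] at hmem

theorem isDiscreteFreeRankTwo_and_pingPong {X Y : SL(2, K)} (hX : translationLength X ≠ 0)
    (hY : translationLength Y ≠ 0) (hle : translationLength X ≤ translationLength Y)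
    (h₁ : (translationLength Y : ℤ) - translationLength X < translationLength (X * Y))
    (h₂ : (translationLength Y : ℤ) - translationLength X < translationLength (X⁻¹ * Y)) :
    IsDiscreteFreeRankTwo (Subgroup.closure {X, Y}) ∧ PingPong (Realization (tree K)) X Y := by
  have hd := isTreeAction K
  have hle' : ∀ (g : SL(2, K)) (q : Vertex K),
      (translationLength g : ℤ) ≤ ((tree K).dist q (g • q) : ℤ) := fun g q => by
    exact_mod_cast translationLength_le g q
  have hex : ∀ g : SL(2, K), ∃ q : Vertex K,
      ((tree K).dist q (g • q) : ℤ) = translationLength g := fun g => by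
    obtain ⟨q, hq⟩ := exists_dist_eq_translationLength g
    exact ⟨q, by exact_mod_cast hq⟩
  obtain ⟨p, S, hp, hne, hS, ha, ha'⟩ :=
    hd.exists_pingPong_sets (g := X) (h := Y)
      (fun q => by have := hle' X q; omega) (fun q => by have := hle' Y q; omega)
      (hle' X) (hex X) (hle' Y) (hex Y) (by exact_mod_cast hle)
      (fun q => h₁.trans_le (hle' _ q)) (fun q => h₂.trans_le (hle' _ q))
  exact isDiscreteFreeRankTwo_and_pingPong_of_sets hp hne
    (fun i j hij u hu v hv => by exact_mod_cast hS i j hij u hu v hv) ha ha'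

end Correctness

end BruhatTits

namespace TreeAlg

/-! ### Invariants and termination of the algorithm -/

section Invariant

variable {G : Type*} [Group G] {l : G → ℕ}

/-- The pair `(X, Y)` generates `H`, and `X` and `Y` have positive translation length. -/
def Admissible (l : G → ℕ) (H : Subgroup G) (X Y : G) : Prop :=
  Subgroup.closure {X, Y} = H ∧ l X ≠ 0 ∧ l Y ≠ 0

/-- The assertions that hold whenever the algorithm with input `A`, `B` is in a given state. -/
def Invariant (l : G → ℕ) (A B : G) : State G → Prop
  | .at₁ X Y => X = A ∧ Y = B
  | .at₂ X Y => Admissible l (Subgroup.closure {A, B}) X Y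
  | .at₃ X Y => Admissible l (Subgroup.closure {A, B}) X Y ∧ l X ≤ l Y
  | .at₄ X Y m => Admissible l (Subgroup.closure {A, B}) X Y ∧ l X ≤ l Y ∧
      m = min (l (X * Y)) (l (X⁻¹ * Y))
  | .at₅ X Y m => Admissible l (Subgroup.closure {A, B}) X Y ∧ l X ≤ l Y ∧
      m = min (l (X * Y)) (l (X⁻¹ * Y)) ∧ m ≠ 0
  | .at₆ X Y => Admissible l (Subgroup.closure {A, B}) X Y ∧ l X ≤ l Y ∧
      (l Y : ℤ) - l X < l (X * Y) ∧ (l Y : ℤ) - l X < l (X⁻¹ * Y)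
  | .returnTrue X Y => Admissible l (Subgroup.closure {A, B}) X Y ∧ l X ≤ l Y ∧
      (l Y : ℤ) - l X < l (X * Y) ∧ (l Y : ℤ) - l X < l (X⁻¹ * Y)
  | .returnFalse => ∃ X Y, Subgroup.closure {X, Y} = Subgroup.closure {A, B} ∧
      (l X = 0 ∨ l Y = 0 ∨ l (X * Y) = 0 ∨ l (X⁻¹ * Y) = 0)

/-- A bound on the number of remaining instructions. -/
def remaining (l : G → ℕ) : State G → ℕ
  | .at₁ X Y => 5 * (l X + l Y) + 7
  | .at₂ X Y => 5 * (l X + l Y) + 6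
  | .at₃ X Y => 5 * (l X + l Y) + 5
  | .at₄ X Y _ => 5 * (l X + l Y) + 4
  | .at₅ X Y _ => 5 * (l X + l Y) + 3
  | .at₆ _ _ => 1
  | .returnFalse => 0
  | .returnTrue _ _ => 0

theorem closure_pair_replace {X Y Z : G} (h : Z = X * Y ∨ Z = X⁻¹ * Y) :
    Subgroup.closure {X, Z} = Subgroup.closure {X, Y} := by
  have hle : ∀ {Y Z : G}, (Z = X * Y ∨ Z = X⁻¹ * Y) →
      Subgroup.closure {X, Z} ≤ Subgroup.closure {X, Y} := by
    intro Y Z h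
    have hX : X ∈ Subgroup.closure {X, Y} := Subgroup.subset_closure (by simp)
    have hY : Y ∈ Subgroup.closure {X, Y} := Subgroup.subset_closure (by simp)
    rw [Subgroup.closure_le]
    rintro _ (rfl | rfl)
    · exact hX
    · rcases h with rfl | rfl
      · exact mul_mem hX hY
      · exact mul_mem (inv_mem hX) hY
  refine le_antisymm (hle h) (hle ?_)
  rcases h with rfl | rfl
  · exact .inr (by group)
  · exact .inl (by group)

theorem Step.invariant {A B : G} {s t : State G} (h : Step l s t) (hs : Invariant l A B s) :
    Invariant l A B t := by
  cases h with
  | elliptic₁ h =>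
    obtain ⟨rfl, rfl⟩ := hs
    exact ⟨_, _, rfl, by tauto⟩
  | hyperbolic₁ h =>
    obtain ⟨rfl, rfl⟩ := hs
    exact ⟨rfl, by tauto⟩
  | swap₂ h => exact ⟨⟨by rw [Set.pair_comm, hs.1], hs.2.2, hs.2.1⟩, h.le⟩
  | keep₂ h => exact ⟨hs, not_lt.mp h⟩
  | compute₃ => exact ⟨hs.1, hs.2, rfl⟩
  | @elliptic₄ X Y m h =>
    obtain ⟨h1, -, h2⟩ := hs
    exact ⟨X, Y, h1.1, by omega⟩
  | hyperbolic₄ h => exact ⟨hs.1, hs.2.1, hs.2.2, h⟩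
  | replace₅ h hZ hm =>
    obtain ⟨h1, -, -, h2⟩ := hs
    exact ⟨(closure_pair_replace hZ).trans h1.1, h1.2.1, by omega⟩
  | otherwise₅ h =>
    obtain ⟨h1, h2, h3, -⟩ := hs
    exact ⟨h1, h2, by omega, by omega⟩
  | return₆ => exact hs

theorem Step.remaining_lt {A B : G} {s t : State G} (h : Step l s t) (hs : Invariant l A B s) :
    remaining l t < remaining l s := by
  cases h with
  -- The new length m is at most l(Y) − l(X) ≤ l(Y) − 1. The gain of at least 5 outweighs the rise
  -- of the constant from 3 to 6.
  | replace₅ h hZ hm =>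
    have := hs.1.2.1
    simp only [remaining]
    omega
  | _ => simp only [remaining]; omega

theorem Run.invariant {n : ℕ} {A B : G} {s : State G} (h : Run l n (.at₁ A B) s) :
    Invariant l A B s ∧ n + remaining l s ≤ remaining l (.at₁ A B) := by
  generalize hs : State.at₁ A B = s₀ at h
  induction h with
  | refl =>
    subst hs
    exact ⟨⟨rfl, rfl⟩, by omega⟩
  | step _ hstep ih =>
    obtain ⟨h1, h2⟩ := ih hs
    have := hstep.remaining_lt h1
    exact ⟨hstep.invariant h1, by omega⟩

/-- The invariant matters at step 5: as m is the minimum, one of the candidates has length m, and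
the algorithm cannot get stuck. -/
theorem Halted.eq_return {A B : G} {s : State G} (h : Halted l s) (hs : Invariant l A B s) :
    s = .returnFalse ∨ ∃ X Y, s = .returnTrue X Y := by
  cases s with
  | at₁ X Y =>
    by_cases hc : l X = 0 ∨ l Y = 0
    · exact absurd (.elliptic₁ hc) (h _)
    · exact absurd (.hyperbolic₁ hc) (h _)
  | at₂ X Y =>
    by_cases hc : l X > l Y
    · exact absurd (.swap₂ hc) (h _)
    · exact absurd (.keep₂ hc) (h _)
  | at₃ X Y => exact absurd .compute₃ (h _)
  | at₄ X Y m =>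
    by_cases hc : m = 0
    · exact absurd (.elliptic₄ hc) (h _)
    · exact absurd (.hyperbolic₄ hc) (h _)
  | at₅ X Y m =>
    by_cases hc : (m : ℤ) ≤ l Y - l X
    · rcases min_choice (l (X * Y)) (l (X⁻¹ * Y)) with hm | hm
      · exact absurd (.replace₅ hc (.inl rfl) (hm.symm.trans hs.2.2.1.symm)) (h _)
      · exact absurd (.replace₅ hc (.inr rfl) (hm.symm.trans hs.2.2.1.symm)) (h _)
    · exact absurd (.otherwise₅ hc) (h _)
  | at₆ X Y => exact absurd .return₆ (h _)
  | returnFalse => exact .inl rfl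
  | returnTrue X Y => exact .inr ⟨X, Y, rfl⟩

end Invariant

end TreeAlg

end

theorem mainTheorem1 (K : Type*) [Field K] [ValuativeRel K] [TopologicalSpace K]
    [IsNonarchimedeanLocalField K] (A B : SL(2, K)) :
    (∃ N : ℕ, ∀ (n : ℕ) (s : TreeAlg.State SL(2, K)),
      TreeAlg.Run BruhatTits.translationLength n (.at₁ A B) s → n ≤ N) ∧
    (∀ (n : ℕ) (s : TreeAlg.State SL(2, K)),
      TreeAlg.Run BruhatTits.translationLength n (.at₁ A B) s →
      TreeAlg.Halted BruhatTits.translationLength s →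
      (IsDiscreteFreeRankTwo (Subgroup.closure {A, B}) ∧
        ∃ X Y : SL(2, K), s = .returnTrue X Y ∧
          Subgroup.closure {X, Y} = Subgroup.closure {A, B} ∧
          PingPong (BruhatTits.Realization (BruhatTits.tree K)) X Y) ∨
      (¬ IsDiscreteFreeRankTwo (Subgroup.closure {A, B}) ∧ s = .returnFalse)) := by

  -- The bound is `remaining` of the initial state, 5(l(A) + l(B)) + 7.
  refine ⟨⟨_, fun n s h => (Nat.le_add_right _ _).trans h.invariant.2⟩, fun n s h hs => ?_⟩
  have hinv := h.invariant.1
  rcases hs.eq_return hinv with rfl | ⟨X, Y, rfl⟩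
  · obtain ⟨X, Y, hcl, hl⟩ := hinv
    rw [← hcl]
    exact .inr ⟨BruhatTits.not_isDiscreteFreeRankTwo_of_translationLength_eq_zero hl, rfl⟩
  · obtain ⟨⟨hcl, hX, hY⟩, hle, h₁, h₂⟩ := hinv
    obtain ⟨h1, h2⟩ := BruhatTits.isDiscreteFreeRankTwo_and_pingPong hX hY hle h₁ h₂
    exact .inl ⟨hcl ▸ h1, X, Y, rfl, hcl, h2⟩
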